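/- Let $p$ be a prime, let $k$ be an algebraic closure of $\mathbb F_p$, and let $\ell\neq p$ be a prime. Let $\eta=\operatorname{Spec}k((u))$, and let $I$ be the absolute Galois group of $k((u))$. An $\ell$-adic local system on $\eta$ is a finite-dimensional continuous $\overline{\mathbb Q}_\ell$-representation of $I$; it is tamely ramified if the wild ramification subgroup $P\subset I$ (the absolute Galois group of the maximal tamely ramified extension of $k((u))$) acts trivially. For $r\ge 1$ write $[r]:\eta\to\eta$, $u\mapsto u^r$. Fix a non-trivial additive character $\psi:\mathbb F_p\to\overline{\mathbb Q}_\ell^{*}$, and for $a\in k((u))$ let $\mathcal L_\psi(a)$ be the pull-back to $\eta$, along $a:\eta\to\mathbb A^1$, of the Artin–Schreier sheaf attached to $\psi$. **Proposition 4.3.** Let $r_1,r_2\ge 1$ be integers, neither of them divisible by $p$. Put $d=\gcd(r_1,r_2)$, $r_i'=r_i/d$, $\rho_i=[r_i]$, $\rho_i'=[r_i']$, $r=r_1r_2/d$ and $\rho=[r]$, and let $\zeta\in k$ be a primitive $r$-th root of unity. Let $\varphi_1,\varphi_2\in t^{-1}k[t^{-1}]$, and for $0\le j\le d-1$ put $$\varphi^{(j)}(u)=\varphi_1\bigl(u^{r_2'}\bigr)+\varphi_2\bigl((\zeta^{j}u)^{r_1'}\bigr).$$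 Let $\mathcal K_1,\mathcal K_2$ be tamely ramified $\ell$-adic local systems on $\eta$, and put $\mathcal K=(\rho_2')^{*}\mathcal K_1\otimes(\rho_1')^{*}\mathcal K_2$. Then $$\rho_{1,*}\bigl(\mathcal L_\psi(\varphi_1(u))\otimes\mathcal K_1\bigr)\otimes\rho_{2,*}\bigl(\mathcal L_\psi(\varphi_2(u))\otimes\mathcal K_2\bigr)\;\cong\;\bigoplus_{j=0}^{d-1}\rho_{*}\bigl(\mathcal L_\psi(\varphi^{(j)}(u))\otimes\mathcal K\bigr).$$ -/

import Mathlib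

open scoped LaurentSeries PowerSeries

namespace LocalSystems

universe u v w

/-! ### Absolute Galois groups and their functoriality -/

section Galois

/-- The absolute Galois group `Gal(F^sep / F)` (with its Krull topology). -/
abbrev AbsGal (F : Type u) [Field F] : Type u :=
  SeparableClosure F ≃ₐ[F] SeparableClosure F

variable {F : Type u} {E : Type v} [Field F] [Field E]

/-- Every embedding of fields `F → E` extends to an embedding `F^sep → E^sep`. -/
theorem exists_sepClosureLift (f : F →+* E) :
    ∃ g : SeparableClosure F →+* SeparableClosure E,
      ∀ x : F, g (algebraMap F (SeparableClosure F) x)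
        = algebraMap E (SeparableClosure E) (f x) := by
  let : Algebra F (SeparableClosure E) :=
    ((algebraMap E (SeparableClosure E)).comp f).toAlgebra
  let g : SeparableClosure F →ₐ[F] SeparableClosure E := IsSepClosed.lift
  exact ⟨g.toRingHom, fun x => g.commutes x⟩

/-- A chosen extension `F^sep → E^sep` of an embedding `F → E`. -/
noncomputable def sepClosureLift (f : F →+* E) :
    SeparableClosure F →+* SeparableClosure E :=
  (exists_sepClosureLift f).choose

theorem sepClosureLift_algebraMap (f : F →+* E) (x : F) :
    sepClosureLift f (algebraMap F (SeparableClosure F) x)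
      = algebraMap E (SeparableClosure E) (f x) :=
  (exists_sepClosureLift f).choose_spec x

theorem exists_galoisRestrict (f : F →+* E) (σ : AbsGal E) :
    ∃ τ : AbsGal F, ∀ x, sepClosureLift f (τ x) = σ (sepClosureLift f x) := by
  let : Algebra F E := f.toAlgebra
  let : Algebra F (SeparableClosure E) :=
    ((algebraMap E (SeparableClosure E)).comp f).toAlgebra
  let : Algebra (SeparableClosure F) (SeparableClosure E) := (sepClosureLift f).toAlgebra
  have : IsScalarTower F E (SeparableClosure E) := IsScalarTower.of_algebraMap_eq fun _ => rfl
  have : IsScalarTower F (SeparableClosure F) (SeparableClosure E) :=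
    IsScalarTower.of_algebraMap_eq fun x => (sepClosureLift_algebraMap f x).symm
  exact ⟨(σ.restrictScalars F).restrictNormal (SeparableClosure F), fun x =>
    (σ.restrictScalars F).restrictNormal_commutes (SeparableClosure F) x⟩

/-- The homomorphism `Gal(E^sep / E) → Gal(F^sep / F)` attached to an embedding `F → E`, that is,
to the morphism `Spec E → Spec F`: the image `τ` of `σ` is determined by
`τ x = σ x` for `x ∈ F^sep ⊆ E^sep`, for the chosen embedding `F^sep ⊆ E^sep` (another choice
changes this homomorphism by a conjugation only). -/
noncomputable def galoisMap (f : F →+* E) : AbsGal E →* AbsGal F where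
  toFun σ := (exists_galoisRestrict f σ).choose
  map_one' := by
    refine AlgEquiv.ext fun x => (sepClosureLift f).injective ?_
    rw [(exists_galoisRestrict f 1).choose_spec]
    rfl
  map_mul' σ σ' := by
    refine AlgEquiv.ext fun x => (sepClosureLift f).injective ?_
    rw [(exists_galoisRestrict f (σ * σ')).choose_spec]
    simp only [AlgEquiv.mul_apply]
    rw [(exists_galoisRestrict f σ).choose_spec, (exists_galoisRestrict f σ').choose_spec]

theorem galoisMap_spec (f : F →+* E) (σ : AbsGal E) (x : SeparableClosure F) :
    sepClosureLift f (galoisMap f σ x) = σ (sepClosureLift f x) :=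
  (exists_galoisRestrict f σ).choose_spec x

end Galois

/-! ### Local systems on the spectrum of a field, pull-back and direct image

A local system on `Spec F` is a finite dimensional continuous representation of the absolute Galois
group of `F`. -/

section LocalSystem

variable {Λ : Type*} {F : Type u} {E : Type v} [Field F] [Field E] [Field Λ]
  {V : Type w} [AddCommGroup V] [Module Λ V]

/-- A representation of `Gal(F^sep / F)` over the topological field `Λ` is a local system on
`Spec F` if it is finite dimensional and continuous (i.e. all its matrix coefficients are
continuous). -/
structure IsLocalSystem [TopologicalSpace Λ] (ρ : Representation Λ (AbsGal F) V) : Prop where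
  finite : Module.Finite Λ V
  continuous_coeff : ∀ (v : V) (l : Module.Dual Λ V), Continuous fun σ : AbsGal F => l (ρ σ v)

/-- The pull-back of a local system along `Spec E → Spec F`. -/
noncomputable def pullback (f : F →+* E) (ρ : Representation Λ (AbsGal F) V) :
    Representation Λ (AbsGal E) V :=
  ρ.comp (galoisMap f)

/-- The direct image of a local system along a finite étale `Spec E → Spec F`, as a representation:
the coinduced representation, on the space of functions `a : Gal(F^sep / F) → V` with
`a (σ|_F · τ) = ρ σ (a τ)` for `σ` in `Gal(E^sep / E)`. Since the image of `Gal(E^sep / E)` has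
finite index, this is also the induced representation. -/
noncomputable def pushforward (f : F →+* E) (ρ : Representation Λ (AbsGal E) V) :
    Representation Λ (AbsGal F) (Representation.coindV (galoisMap f) ρ) :=
  Representation.coind (galoisMap f) ρ

end LocalSystem

/-! ### The Artin-Schreier sheaf -/

section ArtinSchreier

variable {p : ℕ} [Fact p.Prime] {F : Type u} [Field F] [Algebra (ZMod p) F]

/-- The embedding of the prime field `𝔽_p` into `F^sep`. -/
noncomputable def primeFieldHom (p : ℕ) (F : Type u) [Field F] [Algebra (ZMod p) F] :
    ZMod p →+* SeparableClosure F :=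
  (algebraMap F (SeparableClosure F)).comp (algebraMap (ZMod p) F)

theorem exists_artinSchreierRoot (p : ℕ) [Fact p.Prime] [Algebra (ZMod p) F] (a : F) :
    ∃ y : SeparableClosure F, y ^ p - y = algebraMap F (SeparableClosure F) a := by
  classical
  have hp : p.Prime := Fact.out
  have : CharP (SeparableClosure F) p :=
    charP_of_injective_ringHom (primeFieldHom p F).injective p
  let b := algebraMap F (SeparableClosure F) a
  let P : Polynomial (SeparableClosure F) := Polynomial.X ^ p - Polynomial.X - Polynomial.C b
  have hd : P.degree ≠ 0 := by
    have h1 : P.natDegree = p := by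
      simp only [P, sub_sub]
      rw [Polynomial.natDegree_sub_eq_left_of_natDegree_lt]
      · simp
      · rw [Polynomial.natDegree_X_add_C]
        simpa using hp.one_lt
    intro h
    have h2 : P.natDegree = 0 := Polynomial.natDegree_eq_of_degree_eq_some h
    exact hp.ne_zero (h1.symm.trans h2)
  have hs : P.Separable := by
    have hder : Polynomial.derivative P = -1 := by
      simp [P, Polynomial.derivative_X_pow]
    rw [Polynomial.separable_def, hder]
    exact (isCoprime_one_right (x := P)).neg_right
  obtain ⟨y, hy⟩ := IsSepClosed.exists_root P hd hs
  refine ⟨y, ?_⟩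
  simpa [P, Polynomial.IsRoot, sub_eq_zero] using hy

/-- A chosen solution `y` of the Artin-Schreier equation `y ^ p - y = a` in `F^sep`. -/
noncomputable def artinSchreierRoot (p : ℕ) [Fact p.Prime] [Algebra (ZMod p) F] (a : F) :
    SeparableClosure F :=
  (exists_artinSchreierRoot p a).choose

theorem artinSchreierRoot_spec (p : ℕ) [Fact p.Prime] [Algebra (ZMod p) F] (a : F) :
    artinSchreierRoot p a ^ p - artinSchreierRoot p a = algebraMap F (SeparableClosure F) a :=
  (exists_artinSchreierRoot p a).choose_spec

theorem exists_artinSchreierDiff (a : F) (σ : AbsGal F) :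
    ∃ n : ZMod p, primeFieldHom p F n = σ (artinSchreierRoot p a) - artinSchreierRoot p a := by
  have : CharP (SeparableClosure F) p :=
    charP_of_injective_ringHom (primeFieldHom p F).injective p
  have : ExpChar (SeparableClosure F) p := ExpChar.prime Fact.out
  let : Algebra (ZMod p) (SeparableClosure F) := (primeFieldHom p F).toAlgebra
  set y := artinSchreierRoot p a with hy
  have h1 := artinSchreierRoot_spec p a
  have h2 : σ y ^ p - σ y = algebraMap F (SeparableClosure F) a := by
    rw [← map_pow, ← map_sub, ← hy.symm, h1, σ.commutes]
  have h3 : (σ y - y) ^ p = σ y - y := by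
    rw [sub_pow_char]
    rw [← hy] at h1
    linear_combination h2 - h1
  have h4 : (σ y - y) ∈ (algebraMap (ZMod p) (SeparableClosure F)).range := by
    by_contra hcon
    -- the `p` elements of the prime field are already all the roots of `X ^ p - X`
    let Q : Polynomial (SeparableClosure F) := Polynomial.X ^ p - Polynomial.X
    have hQ : Q ≠ 0 := FiniteField.X_pow_card_sub_X_ne_zero _ (Fact.out : p.Prime).one_lt
    have hQd : Q.natDegree = p :=
      FiniteField.X_pow_card_sub_X_natDegree_eq _ (Fact.out : p.Prime).one_lt
    classical
    let S : Finset (SeparableClosure F) :=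
      insert (σ y - y) (Finset.univ.image (algebraMap (ZMod p) (SeparableClosure F)))
    have hS : S.card = p + 1 := by
      rw [Finset.card_insert_of_notMem, Finset.card_image_of_injective _ (RingHom.injective _)]
      · simp [ZMod.card]
      · simpa using hcon
    have hsub : S ⊆ Q.roots.toFinset := by
      intro z hz
      rw [Multiset.mem_toFinset, Polynomial.mem_roots hQ]
      rcases Finset.mem_insert.1 hz with rfl | hz
      · simp [Q, Polynomial.IsRoot, h3]
      · obtain ⟨n, -, rfl⟩ := Finset.mem_image.1 hz
        simp [Q, Polynomial.IsRoot, ← map_pow, ZMod.pow_card]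
    have := (Finset.card_le_card hsub).trans
      ((Multiset.toFinset_card_le _).trans (Polynomial.card_roots' Q))
    omega
  exact h4

/-- For `y ^ p - y = a`, the element `σ y - y` of the prime field `𝔽_p`. It does not depend on the
choice of `y`. -/
noncomputable def artinSchreierDiff (a : F) (σ : AbsGal F) : ZMod p :=
  (exists_artinSchreierDiff (p := p) a σ).choose

theorem artinSchreierDiff_spec (a : F) (σ : AbsGal F) :
    primeFieldHom p F (artinSchreierDiff a σ)
      = σ (artinSchreierRoot p a) - artinSchreierRoot p a :=
  (exists_artinSchreierDiff a σ).choose_spec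

theorem artinSchreierDiff_one (a : F) : artinSchreierDiff (p := p) a 1 = 0 := by
  apply (primeFieldHom p F).injective
  rw [artinSchreierDiff_spec]
  simp

theorem artinSchreierDiff_mul (a : F) (σ τ : AbsGal F) :
    artinSchreierDiff (p := p) a (σ * τ) = artinSchreierDiff a σ + artinSchreierDiff a τ := by
  apply (primeFieldHom p F).injective
  have hτ := artinSchreierDiff_spec (p := p) a τ
  have h : σ (τ (artinSchreierRoot p a)) = σ (artinSchreierRoot p a)
      + primeFieldHom p F (artinSchreierDiff a τ) := by
    have h' : τ (artinSchreierRoot p a) = artinSchreierRoot p a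
      + primeFieldHom p F (artinSchreierDiff a τ) := by rw [hτ]; ring
    rw [h', map_add]
    congr 1
    exact σ.commutes _
  rw [map_add, artinSchreierDiff_spec, artinSchreierDiff_spec, AlgEquiv.mul_apply, h, hτ]
  ring

/-- The pull-back `𝓛_ψ(a)`, along the morphism `a : Spec F → 𝔸¹`, of the Artin-Schreier sheaf
attached to the additive character `ψ` of `𝔽_p`: the rank one representation on which `σ` acts as
multiplication by `ψ (σ y - y)`, where `y ^ p - y = a`. -/
noncomputable def artinSchreier {Λ : Type*} [Field Λ] (ψ : AddChar (ZMod p) Λ) (a : F) :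
    Representation Λ (AbsGal F) Λ where
  toFun σ := ψ (artinSchreierDiff a σ) • LinearMap.id
  map_one' := by
    rw [artinSchreierDiff_one, AddChar.map_zero_eq_one, one_smul]
    rfl
  map_mul' σ τ := by
    rw [artinSchreierDiff_mul, AddChar.map_add_eq_mul]
    ext
    simp [mul_comm]

end ArtinSchreier

/-! ### The formal punctured disc `η = Spec k((t))` -/

section Disc

variable {k : Type u} [Field k]

/-- The coordinate `u` of the Laurent series field `k((u))`. -/
noncomputable def coord (k : Type u) [Field k] : k⸨X⸩ := HahnSeries.single 1 1

/-- The embedding `k((t)) → k((u))`, `∑ aₙ tⁿ ↦ ∑ aₙ u^{rn}`, for `r > 0`; it corresponds to the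
`r`-fold covering `[r] : η → η`, `u ↦ u ^ r`. (The value for `r = 0` is irrelevant.) -/
noncomputable def powMap (k : Type u) [Field k] (r : ℕ) : k⸨X⸩ →+* k⸨X⸩ :=
  if hr : 0 < r then
    HahnSeries.embDomainRingHom (AddMonoidHom.mulLeft (r : ℤ))
      (fun _ _ h => mul_left_cancel₀ (by exact_mod_cast hr.ne') h)
      (fun _ _ => mul_le_mul_iff_right₀ (by exact_mod_cast hr))
  else RingHom.id _

/-- The substitution `φ(x)` of a nonzero Laurent series `x` in an element `φ` of `k[t⁻¹]`. Such a
`φ` is given by the polynomial `P` with `φ = P(t⁻¹)`, so that `φ(x) = P(x⁻¹)`. -/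
noncomputable def evalInv (P : Polynomial k) (x : k⸨X⸩) : k⸨X⸩ :=
  P.eval₂ HahnSeries.C x⁻¹

/-- A finite extension `L` of `K = k((t))` inside `K^sep` is tamely ramified if its ramification
index is prime to the residue characteristic `p`. (The condition that the extension of residue
fields is separable is void, as `k` is algebraically closed in all that follows.) -/
structure IsTamelyRamified (p : ℕ)
    (L : IntermediateField k⸨X⸩ (SeparableClosure k⸨X⸩)) : Prop where
  finite : FiniteDimensional k⸨X⸩ L
  not_dvd : ∀ Q ∈ (IsLocalRing.maximalIdeal k⟦X⟧).primesOver (integralClosure k⟦X⟧ L),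
    ¬ p ∣ Q.ramificationIdx k⟦X⟧

/-- The maximal tamely ramified extension `K^tame` of `K = k((t))`, as the compositum of all the
finite tamely ramified extensions. -/
noncomputable def tameClosure (p : ℕ) (k : Type u) [Field k] :
    IntermediateField k⸨X⸩ (SeparableClosure k⸨X⸩) :=
  ⨆ (L : IntermediateField k⸨X⸩ (SeparableClosure k⸨X⸩)) (_ : IsTamelyRamified p L), L

/-- The wild ramification subgroup `P = Gal(K^sep / K^tame)` of `I = Gal(K^sep / K)`. -/
noncomputable def wildInertia (p : ℕ) (k : Type u) [Field k] : Subgroup (AbsGal k⸨X⸩) :=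
  (tameClosure p k).fixingSubgroup

/-- A representation of `I` is tamely ramified if the wild ramification subgroup acts trivially. -/
def IsTame (p : ℕ) {Λ : Type*} [Field Λ] {V : Type w} [AddCommGroup V] [Module Λ V]
    (ρ : Representation Λ (AbsGal k⸨X⸩) V) : Prop :=
  ∀ σ ∈ wildInertia p k, ρ σ = 1

end Disc

end LocalSystems

/-! Direct image along `[r]` is coinduction from a subgroup of index `r` in the absolute Galois
group `I` of `k((t))`, so the theorem is an instance of Mackey's formula
(`nonempty_equiv_tprod_coind`). Let `s` be an `r`-th root of the coordinate. The Kummer character `g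
↦ g s / s` maps `I` onto `ℤ/r`, and up to conjugation the three subgroups are the preimages of
`r₁ℤ/r`, of `r₂ℤ/r` and of `0`. Hence the double cosets form `ℤ/d`, and each one contributes a
coinduction from the subgroup of `[r]` (`exists_doubleCoset`).

The `j`-th double coset is represented by an element inducing the rotation `u ↦ ζ^j u`
(`exists_absGal_rotate`). In that summand the first factor is pulled back along `u ↦ u^{r₂'}` and
the second along `u ↦ (ζ^j u)^{r₁'}`. Functoriality and additivity of the Artin-Schreier cocycle
turn the rank one parts into `𝓛_ψ(φ^{(j)})`.

The rotation disappears from the second tame factor because it acts trivially on the tame quotient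
of `I` (`galoisMap_conjAbsGal_mem_wildInertia`). Every finite tame extension is generated by a root
of the coordinate (`exists_root_of_isTamelyRamified`, by Hensel's lemma). On such roots both
rotations and Galois elements act through multiplication by constants, so their actions commute.

Embeddings of separable closures are chosen arbitrarily, so `galoisMap` respects composition only up
to conjugation. The conjugating elements are absorbed into the double coset representatives. -/

namespace LocalSystems

universe u v w

open scoped TensorProduct DirectSum

/-! ### Coinduced representations and Mackey's formula -/

section Mackey

open Module

variable {Λ G H H₁ H₂ V V₁ V₂ W : Type*} [Field Λ] [Group G] [Group H] [Group H₁] [Group H₂]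
  [AddCommGroup V] [Module Λ V] [AddCommGroup V₁] [Module Λ V₁] [AddCommGroup V₂] [Module Λ V₂]
  [AddCommGroup W] [Module Λ W]

theorem exists_eq_mul_out (f : H →* G) (g : G) :
    ∃ h : H, g = f h * (Quotient.mk (QuotientGroup.rightRel f.range) g).out := by
  have h := Quotient.exact (Quotient.out_eq (Quotient.mk (QuotientGroup.rightRel f.range) g))
  change QuotientGroup.rightRel f.range _ _ at h
  rw [QuotientGroup.rightRel_apply] at h
  obtain ⟨h, hh⟩ := h
  exact ⟨h, by rw [hh]; group⟩

/-- A function in the coinduced representation is determined by its values on a system of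
representatives of the right cosets, and these may be prescribed. -/
noncomputable def coindEquiv (f : H →* G) (hf : Function.Injective f)
    (ρ : Representation Λ H V) :
    Representation.coindV f ρ ≃ₗ[Λ] (Quotient (QuotientGroup.rightRel f.range) → V) :=
  LinearEquiv.ofBijective
    ((LinearMap.funLeft Λ V Quotient.out).comp (Representation.coindV f ρ).subtype) <| by
    constructor
    · rw [← LinearMap.ker_eq_bot, LinearMap.ker_eq_bot']
      intro a ha
      ext g
      obtain ⟨h, hh⟩ := exists_eq_mul_out f g
      have h0 : a.1 (Quotient.mk (QuotientGroup.rightRel f.range) g).out = 0 := congrFun ha _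
      rw [hh, a.2, h0, map_zero]
      rfl
    · intro c
      choose s hs using exists_eq_mul_out f
      have key (h : H) (g : G) : Quotient.mk (QuotientGroup.rightRel f.range) (f h * g)
          = Quotient.mk (QuotientGroup.rightRel f.range) g := by
        apply Quotient.sound
        change QuotientGroup.rightRel f.range _ _
        rw [QuotientGroup.rightRel_apply]
        exact ⟨h⁻¹, by simp⟩
      refine ⟨⟨fun g => ρ (s g) (c (Quotient.mk _ g)), fun h g => ?_⟩, ?_⟩
      -- As `f` is injective, the `H`-component `s g` of `g` relative to its coset representative is
      -- unique, hence equivariant.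
      · have : s (f h * g) = h * s g := by
          apply hf
          apply mul_right_cancel (b := (Quotient.mk (QuotientGroup.rightRel f.range) g).out)
          rw [map_mul, mul_assoc, ← hs g, ← key h g, ← hs]
        change ρ (s (f h * g)) (c (Quotient.mk _ (f h * g))) = ρ h (ρ (s g) (c (Quotient.mk _ g)))
        rw [this, key, map_mul]
        rfl
      · funext q
        have h1 : s q.out = 1 := by
          apply hf
          apply mul_right_cancel (b := q.out)
          conv_rhs => rw [map_one, one_mul, hs q.out]
          rw [Quotient.out_eq]
        change ρ (s q.out) (c (Quotient.mk _ q.out)) = c q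
        rw [h1, Quotient.out_eq, map_one]
        rfl

theorem finite_rightRel (S : Subgroup G) [S.FiniteIndex] :
    Finite (Quotient (QuotientGroup.rightRel S)) :=
  Finite.of_equiv _ (QuotientGroup.quotientRightRelEquivQuotientLeftRel S).symm

theorem finite_coindV (f : H →* G) (hf : Function.Injective f) [f.range.FiniteIndex]
    (ρ : Representation Λ H V) [Module.Finite Λ V] :
    Module.Finite Λ (Representation.coindV f ρ) := by
  have := finite_rightRel f.range
  exact Module.Finite.equiv (coindEquiv f hf ρ).symm

theorem finrank_coindV (f : H →* G) (hf : Function.Injective f) [f.range.FiniteIndex]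
    (ρ : Representation Λ H V) [Module.Finite Λ V] :
    finrank Λ (Representation.coindV f ρ) = f.range.index * finrank Λ V := by
  have := finite_rightRel f.range
  have := Fintype.ofFinite (Quotient (QuotientGroup.rightRel f.range))
  rw [(coindEquiv f hf ρ).finrank_eq, Module.finrank_pi_fintype, Finset.sum_const, smul_eq_mul,
    Finset.card_univ, ← Nat.card_eq_fintype_card,
    Nat.card_congr (QuotientGroup.quotientRightRelEquivQuotientLeftRel f.range)]
  rfl

/-- A tensor of finite products is the sum of its components, reinserted by the coordinate
inclusions (`key`). -/
theorem tensor_pi_eq_zero {ι₁ ι₂ : Type*} [Finite ι₁] [Finite ι₂]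
    (t : (ι₁ → V₁) ⊗[Λ] (ι₂ → V₂))
    (ht : ∀ i j, TensorProduct.map (LinearMap.proj i : (ι₁ → V₁) →ₗ[Λ] V₁)
      (LinearMap.proj j : (ι₂ → V₂) →ₗ[Λ] V₂) t = 0) : t = 0 := by
  classical
  have := Fintype.ofFinite ι₁
  have := Fintype.ofFinite ι₂
  have key : t = ∑ i, ∑ j, TensorProduct.map (LinearMap.single Λ (fun _ : ι₁ => V₁) i)
      (LinearMap.single Λ (fun _ : ι₂ => V₂) j)
      (TensorProduct.map (LinearMap.proj i : (ι₁ → V₁) →ₗ[Λ] V₁)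
        (LinearMap.proj j : (ι₂ → V₂) →ₗ[Λ] V₂) t) := by
    clear ht
    induction t with
    | zero => simp
    | add x y hx hy =>
      conv_lhs => rw [hx, hy]
      simp only [map_add, Finset.sum_add_distrib]
    | tmul x y =>
      have hx : x = ∑ i, LinearMap.single Λ (fun _ : ι₁ => V₁) i (x i) := by
        simp [LinearMap.coe_single, Finset.univ_sum_single]
      have hy : y = ∑ i, LinearMap.single Λ (fun _ : ι₂ => V₂) i (y i) := by
        simp [LinearMap.coe_single, Finset.univ_sum_single]
      conv_lhs => rw [hx, hy]
      simp only [TensorProduct.map_tmul, TensorProduct.sum_tmul, TensorProduct.tmul_sum,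
        LinearMap.proj_apply]
      exact Finset.sum_comm
  rw [key]
  simp [ht]

/-- Evaluation of functions at an element of the group. -/
def coindEval (f : H →* G) (ρ : Representation Λ H V) (g : G) :
    Representation.coindV f ρ →ₗ[Λ] V :=
  (LinearMap.proj g).comp (Representation.coindV f ρ).subtype

theorem coindEval_mul (f : H →* G) (ρ : Representation Λ H V) (h : H) (g : G) :
    coindEval f ρ (f h * g) = (ρ h).comp (coindEval f ρ g) := by
  ext a
  exact a.2 h g

theorem coindEval_comp_coind (f : H →* G) (ρ : Representation Λ H V) (g g' : G) :
    (coindEval f ρ g).comp (Representation.coind f ρ g') = coindEval f ρ (g * g') := rfl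

/-- Evaluation at coset representatives identifies both factors with finite products. This is the
source of injectivity in Mackey's formula. -/
theorem tensor_coind_eq_zero (f₁ : H₁ →* G) (f₂ : H₂ →* G) (hf₁ : Function.Injective f₁)
    (hf₂ : Function.Injective f₂) [f₁.range.FiniteIndex] [f₂.range.FiniteIndex]
    (ρ₁ : Representation Λ H₁ V₁) (ρ₂ : Representation Λ H₂ V₂)
    (t : Representation.coindV f₁ ρ₁ ⊗[Λ] Representation.coindV f₂ ρ₂)
    (ht : ∀ g₁ g₂, TensorProduct.map (coindEval f₁ ρ₁ g₁) (coindEval f₂ ρ₂ g₂) t = 0) :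
    t = 0 := by
  have := finite_rightRel f₁.range
  have := finite_rightRel f₂.range
  apply (TensorProduct.congr (coindEquiv f₁ hf₁ ρ₁) (coindEquiv f₂ hf₂ ρ₂)).injective
  rw [map_zero]
  refine tensor_pi_eq_zero _ fun i j => ?_
  rw [← ht i.out j.out]
  change (TensorProduct.map _ _) ((TensorProduct.map _ _) t) = _
  rw [← LinearMap.comp_apply, ← TensorProduct.map_comp]
  rfl

/-- An injective linear map of vector spaces of the same finite dimension, as an equivalence. -/
noncomputable def equivOfKerEqZero {M N : Type*} [AddCommMonoid M] [AddCommMonoid N] [Module Λ M]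
    [Module Λ N] [Module.Finite Λ M] [Module.Finite Λ N] (f : M →ₗ[Λ] N)
    (hf : ∀ x, f x = 0 → x = 0) (h : finrank Λ M = finrank Λ N) : M ≃ₗ[Λ] N :=
  -- Negation is multiplication by the scalar `-1`, so additive monoid structures on the spaces
  -- suffice.
  letI := Module.addCommMonoidToAddCommGroup Λ (M := M)
  letI := Module.addCommMonoidToAddCommGroup Λ (M := N)
  LinearEquiv.ofInjectiveOfFinrankEq f ((injective_iff_map_eq_zero f).2 hf) h

/-- **Mackey's formula** for the tensor product of two representations coinduced from subgroups of
finite index. The double cosets are represented by the pairs `(x i, y i)`. -/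
theorem nonempty_equiv_tprod_coind {ι : Type*} [Fintype ι] [DecidableEq ι]
    (f₁ : H₁ →* G) (f₂ : H₂ →* G) (f : H →* G) (hf₁ : Function.Injective f₁)
    (hf₂ : Function.Injective f₂) (hf : Function.Injective f)
    [f₁.range.FiniteIndex] [f₂.range.FiniteIndex] [f.range.FiniteIndex]
    (ρ₁ : Representation Λ H₁ V₁) (ρ₂ : Representation Λ H₂ V₂)
    (ρ : ι → Representation Λ H W)
    [Module.Finite Λ V₁] [Module.Finite Λ V₂]
    (α : ι → H → H₁) (β : ι → H → H₂) (x y : ι → G)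
    (hα : ∀ i h, f₁ (α i h) * x i = x i * f h) (hβ : ∀ i h, f₂ (β i h) * y i = y i * f h)
    (hcover : ∀ g₁ g₂ : G, ∃ i h₁ h₂ g, g₁ = f₁ h₁ * (x i * g) ∧ g₂ = f₂ h₂ * (y i * g))
    (hindex : f₁.range.index * f₂.range.index = Fintype.card ι * f.range.index)
    (e : V₁ ⊗[Λ] V₂ ≃ₗ[Λ] W)
    (he : ∀ i h, e.toLinearMap.comp (TensorProduct.map (ρ₁ (α i h)) (ρ₂ (β i h)))
      = (ρ i h).comp e.toLinearMap) :
    Nonempty (Representation.Equiv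
      (Representation.tprod (Representation.coind f₁ ρ₁) (Representation.coind f₂ ρ₂))
      (Representation.directSum fun i => Representation.coind f (ρ i))) := by
  have := Module.Finite.equiv e
  have := finite_coindV f₁ hf₁ ρ₁
  have := finite_coindV f₂ hf₂ ρ₂
  have hfin (i : ι) := finite_coindV f hf (ρ i)
  -- The Mackey map sends `a ⊗ b` to the functions `g ↦ e (a (x i * g) ⊗ b (y i * g))`.
  let ev (i : ι) (g : G) : Representation.coindV f₁ ρ₁ ⊗[Λ] Representation.coindV f₂ ρ₂ →ₗ[Λ] W :=
    e.toLinearMap.comp (TensorProduct.map (coindEval f₁ ρ₁ (x i * g)) (coindEval f₂ ρ₂ (y i * g)))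
  have hev (i : ι) (h : H) (g : G) : ev i (f h * g) = (ρ i h).comp (ev i g) := by
    simp only [ev]
    rw [← mul_assoc, ← mul_assoc, ← hα, ← hβ, mul_assoc, mul_assoc, coindEval_mul, coindEval_mul,
      TensorProduct.map_comp, ← LinearMap.comp_assoc, he, LinearMap.comp_assoc]
  let Φ (i : ι) : Representation.coindV f₁ ρ₁ ⊗[Λ] Representation.coindV f₂ ρ₂ →ₗ[Λ]
      Representation.coindV f (ρ i) :=
    (LinearMap.pi (ev i)).codRestrict _ fun t h g => LinearMap.congr_fun (hev i h g) t
  let D := DirectSum.linearEquivFunOnFintype Λ ι fun i => Representation.coindV f (ρ i)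
  -- By `hcover`, every pair `(g₁, g₂)` is reached from some `(x i * g, y i * g)` by left
  -- translation, under which evaluation changes only by `ρ₁ h₁ ⊗ ρ₂ h₂`.
  have hinj (t) (ht : LinearMap.pi Φ t = 0) : t = 0 := by
    refine tensor_coind_eq_zero f₁ f₂ hf₁ hf₂ ρ₁ ρ₂ t fun g₁ g₂ => ?_
    obtain ⟨i, h₁, h₂, g, rfl, rfl⟩ := hcover g₁ g₂
    have h0 : ev i g t = 0 := by
      have : (LinearMap.pi Φ t i).1 g = 0 := by rw [ht]; rfl
      exact this
    have h1 := e.injective (h0.trans (map_zero e).symm)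
    rw [coindEval_mul, coindEval_mul, TensorProduct.map_comp, LinearMap.comp_apply]
    exact (congrArg _ h1).trans (map_zero _)
  -- Equality of dimensions, from `hindex`, replaces a proof of surjectivity and of disjointness of
  -- the double cosets.
  have hrank : finrank Λ (Representation.coindV f₁ ρ₁ ⊗[Λ] Representation.coindV f₂ ρ₂)
      = finrank Λ (∀ i, Representation.coindV f (ρ i)) := by
    rw [Module.finrank_pi_fintype, Module.finrank_tensorProduct, finrank_coindV f₁ hf₁,
      finrank_coindV f₂ hf₂]
    simp only [finrank_coindV f hf, ← e.finrank_eq, Module.finrank_tensorProduct,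
      Finset.sum_const, smul_eq_mul, Finset.card_univ]
    linear_combination (finrank Λ V₁ * finrank Λ V₂) * hindex
  let Ψ := (equivOfKerEqZero (LinearMap.pi Φ) hinj hrank).trans D.symm
  have hΨ (t) (i : ι) : Ψ t i = Φ i t := congrFun (D.apply_symm_apply (LinearMap.pi Φ t)) i
  refine ⟨Representation.Equiv.mk Ψ fun g => ?_⟩
  refine LinearMap.ext fun t => DFinsupp.ext fun i => ?_
  apply Subtype.ext
  funext g'
  have h1 : (Representation.directSum (fun i => Representation.coind f (ρ i)) g (Ψ t)) i
      = Representation.coind f (ρ i) g (Φ i t) := by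
    rw [← hΨ]
    rfl
  have h2 : ev i g' (TensorProduct.map (Representation.coind f₁ ρ₁ g)
      (Representation.coind f₂ ρ₂ g) t) = ev i (g' * g) t := by
    have h3 : TensorProduct.map (coindEval f₁ ρ₁ (x i * (g' * g)))
        (coindEval f₂ ρ₂ (y i * (g' * g))) = (TensorProduct.map (coindEval f₁ ρ₁ (x i * g'))
          (coindEval f₂ ρ₂ (y i * g'))).comp (TensorProduct.map (Representation.coind f₁ ρ₁ g)
            (Representation.coind f₂ ρ₂ g)) := by
      rw [← TensorProduct.map_comp, coindEval_comp_coind, coindEval_comp_coind, mul_assoc,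
        mul_assoc]
    exact (congrArg e (LinearMap.congr_fun h3 t)).symm
  change ((Ψ (TensorProduct.map (Representation.coind f₁ ρ₁ g)
      (Representation.coind f₂ ρ₂ g) t)) i).1 g' =
    ((Representation.directSum (fun i => Representation.coind f (ρ i)) g (Ψ t)) i).1 g'
  rw [h1, hΨ]
  exact h2

end Mackey

/-! ### Power substitutions and rotations of Laurent series -/

section Laurent

variable {k : Type u} [Field k]

theorem coeff_powMap_mul {r : ℕ} (hr : 0 < r) (x : k⸨X⸩) (n : ℤ) :
    (powMap k r x).coeff (r * n) = x.coeff n := by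
  rw [powMap, dif_pos hr]
  exact HahnSeries.embDomain_coeff

theorem coeff_powMap_of_not_dvd {r : ℕ} (hr : 0 < r) (x : k⸨X⸩) {n : ℤ} (hn : ¬ (r : ℤ) ∣ n) :
    (powMap k r x).coeff n = 0 := by
  rw [powMap, dif_pos hr]
  refine HahnSeries.embDomain_of_notMem_range ?_
  rintro ⟨m, rfl⟩
  exact hn (dvd_mul_right _ _)

theorem powMap_C {r : ℕ} (hr : 0 < r) (c : k) : powMap k r (HahnSeries.C c) = HahnSeries.C c := by
  rw [powMap, dif_pos hr]
  exact HahnSeries.embDomainRingHom_C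

theorem coord_pow (n : ℕ) : coord k ^ n = HahnSeries.single (n : ℤ) 1 := by
  simp [coord, HahnSeries.single_pow]

theorem coord_ne_zero : coord k ≠ 0 := by
  simp [coord]

theorem powMap_coord {r : ℕ} (hr : 0 < r) : powMap k r (coord k) = coord k ^ r := by
  rw [coord_pow, powMap, dif_pos hr]
  change HahnSeries.embDomain _ (HahnSeries.single 1 1) = _
  rw [HahnSeries.embDomain_single]
  simp

theorem powMap_comp {r s : ℕ} (hr : 0 < r) (hs : 0 < s) :
    (powMap k r).comp (powMap k s) = powMap k (s * r) := by
  ext x n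
  have hr' : (r : ℤ) ≠ 0 := by positivity
  rw [RingHom.comp_apply]
  by_cases h : (r : ℤ) ∣ n
  · obtain ⟨m, rfl⟩ := h
    rw [coeff_powMap_mul hr]
    by_cases h : (s : ℤ) ∣ m
    · obtain ⟨l, rfl⟩ := h
      rw [coeff_powMap_mul hs, ← coeff_powMap_mul (Nat.mul_pos hs hr)]
      congr 1
      push_cast
      ring
    · rw [coeff_powMap_of_not_dvd hs _ h, coeff_powMap_of_not_dvd (Nat.mul_pos hs hr)]
      rwa [Nat.cast_mul, mul_comm, mul_dvd_mul_iff_left hr']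
  · rw [coeff_powMap_of_not_dvd hr _ h, coeff_powMap_of_not_dvd (Nat.mul_pos hs hr)]
    intro h'
    rw [Nat.cast_mul] at h'
    exact h ((dvd_mul_left _ _).trans h')

/-- The series `∑ x_{rn+i} tⁿ`. -/
noncomputable def dissect (r : ℕ) (hr : 0 < r) (i : ℕ) (x : k⸨X⸩) : k⸨X⸩ :=
  HahnSeries.ofSuppBddBelow (fun n : ℤ => x.coeff (r * n + i)) <| by
    refine ⟨-(|x.order| + i), fun n hn => ?_⟩
    by_contra hlt
    rw [not_le] at hlt
    refine hn (HahnSeries.coeff_eq_zero_of_lt_order ?_)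
    have h1 := neg_abs_le x.order
    have h2 := abs_nonneg x.order
    -- Here `n ≤ 0` and `r ≥ 1`, so the exponent `r * n + i` is at most `n + i`, which is below the
    -- order of `x`.
    have h3 : (r : ℤ) * n ≤ 1 * n := by
      rw [← sub_nonneg, ← sub_mul]
      exact mul_nonneg_of_nonpos_of_nonpos (by omega) (by omega)
    omega

theorem coeff_dissect (r : ℕ) (hr : 0 < r) (i : ℕ) (x : k⸨X⸩) (n : ℤ) :
    (dissect r hr i x).coeff n = x.coeff (r * n + i) := rfl

/-- Sorting exponents by their residue modulo `r` shows that `1, u, …, u^(r-1)` span `k((u))` over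
`k((u^r))`. -/
theorem eq_sum_dissect (r : ℕ) (hr : 0 < r) (x : k⸨X⸩) :
    x = ∑ i ∈ Finset.range r, coord k ^ i * powMap k r (dissect r hr i x) := by
  ext n
  have hr' : (0 : ℤ) < r := by positivity
  have hc (i : ℕ) (y : k⸨X⸩) : (coord k ^ i * y).coeff n = y.coeff (n - i) := by
    rw [coord_pow, HahnSeries.coeff_single_mul, one_mul]
  have h0 := Int.emod_nonneg n hr'.ne'
  have h1 := Int.emod_lt_of_pos n hr'
  have h2 := Int.mul_ediv_add_emod n r
  rw [HahnSeries.coeff_sum, Finset.sum_eq_single (n % r).toNat]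
  · have h : n - ((n % r).toNat : ℤ) = r * (n / r) := by omega
    rw [hc, h, coeff_powMap_mul hr, coeff_dissect]
    congr 1
    omega
  · intro i hi hne
    rw [Finset.mem_range] at hi
    rw [hc, coeff_powMap_of_not_dvd hr]
    rintro ⟨m, hm⟩
    apply hne
    have : n = i + r * m := by omega
    rw [this, Int.add_mul_emod_self_left, Int.emod_eq_of_lt] <;> omega
  · intro h
    exact absurd (Finset.mem_range.2 (by omega)) h

/-- The automorphism `u ↦ c u` of the field `k((u))`. -/
noncomputable def rotate (c : kˣ) : k⸨X⸩ →+* k⸨X⸩ where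
  toFun x :=
    { coeff := fun n => ((c ^ n : kˣ) : k) * x.coeff n
      isPWO_support' := x.isPWO_support.mono fun n => by simp }
  map_one' := by
    ext n
    by_cases h : n = 0 <;> simp [HahnSeries.coeff_one, h]
  map_zero' := by ext; simp
  map_add' x y := by ext; simp [mul_add]
  map_mul' x y := by
    ext n
    simp only [HahnSeries.coeff_mul, Finset.mul_sum]
    refine Finset.sum_congr ?_ fun ij hij => ?_
    · ext ij
      simp [zpow_ne_zero _ c.ne_zero]
    · rw [Finset.mem_antidiagonal] at hij
      rw [← hij.2.2, zpow_add, Units.val_mul]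
      ring

theorem coeff_rotate (c : kˣ) (x : k⸨X⸩) (n : ℤ) :
    (rotate c x).coeff n = ((c ^ n : kˣ) : k) * x.coeff n := rfl

theorem rotate_C (c : kˣ) (a : k) : rotate c (HahnSeries.C a) = HahnSeries.C a := by
  ext n
  by_cases h : n = 0 <;> simp [coeff_rotate, HahnSeries.C_apply, h]

theorem rotate_coord (c : kˣ) : rotate c (coord k) = HahnSeries.C (c : k) * coord k := by
  ext n
  by_cases h : n = 1 <;> simp [coeff_rotate, coord, h]

theorem rotate_rotate_inv (c : kˣ) (x : k⸨X⸩) : rotate c (rotate c⁻¹ x) = x := by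
  ext n
  rw [coeff_rotate, coeff_rotate, ← mul_assoc, ← Units.val_mul, ← mul_zpow]
  simp

/-- Only exponents divisible by `r` occur, and there the factor `c ^ n` is `1`; so this rotation is
an automorphism over `k((u^r))`. -/
theorem rotate_powMap {r : ℕ} (hr : 0 < r) {c : kˣ} (hc : c ^ r = 1) (x : k⸨X⸩) :
    rotate c (powMap k r x) = powMap k r x := by
  ext n
  rw [coeff_rotate]
  by_cases h : (r : ℤ) ∣ n
  · obtain ⟨m, rfl⟩ := h
    simp [zpow_mul, hc]
  · rw [coeff_powMap_of_not_dvd hr _ h, mul_zero]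

theorem map_evalInv (f : k⸨X⸩ →+* k⸨X⸩) (hf : ∀ c, f (HahnSeries.C c) = HahnSeries.C c)
    (P : Polynomial k) (x : k⸨X⸩) : f (evalInv P x) = evalInv P (f x) := by
  rw [evalInv, evalInv, Polynomial.hom_eval₂, map_inv₀]
  congr 1
  ext1 c
  exact hf c

end Laurent

/-! ### Galois groups of Kummer extensions and the Artin-Schreier cocycle -/

section KummerExtension

variable {F : Type u} {E : Type v} [Field F] [Field E]

/-- `E^sep` is separable over `F`, hence over the image of `F^sep`, which is already separably
closed. -/
theorem sepClosureLift_surjective_of_isSeparable (f : F →+* E)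
    (h : @Algebra.IsSeparable F E _ _ f.toAlgebra) : Function.Surjective (sepClosureLift f) := by
  let : Algebra F E := f.toAlgebra
  let : Algebra F (SeparableClosure E) :=
    ((algebraMap E (SeparableClosure E)).comp f).toAlgebra
  let : Algebra (SeparableClosure F) (SeparableClosure E) := (sepClosureLift f).toAlgebra
  have : IsScalarTower F E (SeparableClosure E) := IsScalarTower.of_algebraMap_eq fun _ => rfl
  have : IsScalarTower F (SeparableClosure F) (SeparableClosure E) :=
    IsScalarTower.of_algebraMap_eq fun x => (sepClosureLift_algebraMap f x).symm
  have : Algebra.IsSeparable F E := h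
  have : Algebra.IsSeparable F (SeparableClosure E) := Algebra.IsSeparable.trans F E _
  have : Algebra.IsSeparable (SeparableClosure F) (SeparableClosure E) :=
    Algebra.isSeparable_tower_top_of_isSeparable F _ _
  exact IsSepClosed.algebraMap_surjective (SeparableClosure F) (SeparableClosure E)

/-- The embedding `f : F → E` makes `E` the Kummer extension of `F` generated by an `r`-th root `u`
of `t`. -/
structure IsKummer (f : F →+* E) (r : ℕ) (t : F) (u : E) : Prop where
  ne_zero : t ≠ 0
  cast_ne_zero : (r : F) ≠ 0
  pow_eq : u ^ r = f t
  exists_eq_sum : ∀ x : E, ∃ c : ℕ → F, x = ∑ i ∈ Finset.range r, u ^ i * f (c i)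

namespace IsKummer

variable {f : F →+* E} {r : ℕ} {t : F} {u : E}

theorem sepClosureLift_surjective (h : IsKummer f r t u) :
    Function.Surjective (sepClosureLift f) := by
  apply sepClosureLift_surjective_of_isSeparable
  let : Algebra F E := f.toAlgebra
  have hu : IsSeparable F u := by
    have hsep := Polynomial.separable_X_pow_sub_C t h.cast_ne_zero h.ne_zero
    refine hsep.of_dvd (minpoly.dvd F u ?_)
    rw [map_sub, map_pow, Polynomial.aeval_X, Polynomial.aeval_C, h.pow_eq]
    exact sub_self _
  have htop : IntermediateField.adjoin F {u} = ⊤ := by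
    refine eq_top_iff.2 fun x _ => ?_
    obtain ⟨c, rfl⟩ := h.exists_eq_sum x
    exact sum_mem fun i _ => mul_mem (pow_mem (IntermediateField.mem_adjoin_simple_self F u) _)
      (algebraMap_mem _ (c i))
  have h1 := (IntermediateField.isSeparable_adjoin_simple_iff_isSeparable F E).2 hu
  rw [htop] at h1
  exact Algebra.IsSeparable.of_algHom F _ (IntermediateField.topEquiv (F := F) (E := E)).symm.toAlgHom

end IsKummer

theorem sepClosureLift_surjective_of_surjective {f : F →+* E} (hf : Function.Surjective f) :
    Function.Surjective (sepClosureLift f) := by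
  -- A surjective embedding is the trivial Kummer extension, with `r = t = u = 1`.
  have h : IsKummer f 1 1 1 := by
    refine ⟨one_ne_zero, by simp, by simp, fun x => ?_⟩
    obtain ⟨y, rfl⟩ := hf x
    exact ⟨fun _ => y, by simp⟩
  exact h.sepClosureLift_surjective

theorem galoisMap_injective {f : F →+* E} (hf : Function.Surjective (sepClosureLift f)) :
    Function.Injective (galoisMap f) := by
  intro σ τ h
  refine AlgEquiv.ext fun x => ?_
  obtain ⟨y, rfl⟩ := hf x
  rw [← galoisMap_spec, h, galoisMap_spec]

theorem galoisMap_eq_of_forall {f : F →+* E} {σ : AbsGal E} {τ : AbsGal F}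
    (h : ∀ x, sepClosureLift f (τ x) = σ (sepClosureLift f x)) : galoisMap f σ = τ := by
  refine AlgEquiv.ext fun x => ?_
  apply (sepClosureLift f).injective
  rw [galoisMap_spec, h]

/-- Two extensions of an embedding `F → E` to an isomorphism `F^sep → E^sep` differ by an element
of the Galois group. -/
theorem exists_absGal_of_lifts {f : F →+* E} (i j : SeparableClosure F →+* SeparableClosure E)
    (hi : ∀ x, i (algebraMap F _ x) = algebraMap E _ (f x))
    (hj : ∀ x, j (algebraMap F _ x) = algebraMap E _ (f x))
    (hi' : Function.Surjective i) (hj' : Function.Surjective j) :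
    ∃ x : AbsGal F, ∀ z, i (x z) = j z := by
  let e := RingEquiv.ofBijective i ⟨i.injective, hi'⟩
  let e' := RingEquiv.ofBijective j ⟨j.injective, hj'⟩
  have he (z) : i (e.symm z) = z := e.apply_symm_apply z
  refine ⟨AlgEquiv.ofRingEquiv (f := e'.trans e.symm) fun x => ?_, fun z => he (j z)⟩
  apply i.injective
  rw [hi, ← hj]
  exact he _

/-- If `i : F^sep → E^sep` is an isomorphism such that conjugation by `i` induces the homomorphism
`φ` on the absolute Galois group of `E`, then `φ` is conjugate to `galoisMap f`. -/
theorem exists_conj_galoisMap {f : F →+* E} (hf : Function.Surjective (sepClosureLift f))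
    (i : SeparableClosure F →+* SeparableClosure E) (hi' : Function.Surjective i)
    (hi : ∀ x, i (algebraMap F _ x) = algebraMap E _ (f x)) (φ : AbsGal E → AbsGal F)
    (hφ : ∀ σ z, i (φ σ z) = σ (i z)) :
    ∃ x : AbsGal F, ∀ σ, φ σ * x = x * galoisMap f σ := by
  obtain ⟨x, hx⟩ := exists_absGal_of_lifts i (sepClosureLift f) hi (sepClosureLift_algebraMap f)
    hi' hf
  refine ⟨x, fun σ => ?_⟩
  refine AlgEquiv.ext fun z => ?_
  apply i.injective
  rw [AlgEquiv.mul_apply, AlgEquiv.mul_apply, hφ, hx, hx, galoisMap_spec]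

/-- Extension of a field endomorphism `θ` of `E` to `E^sep`, if `θ` is surjective. -/
noncomputable def sepClosureEquiv (θ : E →+* E) (hθ : Function.Surjective θ) :
    SeparableClosure E ≃+* SeparableClosure E :=
  RingEquiv.ofBijective (sepClosureLift θ)
    ⟨(sepClosureLift θ).injective, sepClosureLift_surjective_of_surjective hθ⟩

theorem sepClosureEquiv_algebraMap (θ : E →+* E) (hθ : Function.Surjective θ) (x : E) :
    sepClosureEquiv θ hθ (algebraMap E _ x) = algebraMap E _ (θ x) :=
  sepClosureLift_algebraMap θ x

/-- The automorphism `Θ⁻¹ σ Θ` of `E^sep`, for an extension `Θ` of an automorphism `θ` of `E`. -/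
noncomputable def conjAbsGal (θ : E →+* E) (hθ : Function.Surjective θ) (σ : AbsGal E) :
    AbsGal E :=
  AlgEquiv.ofRingEquiv
    (f := ((sepClosureEquiv θ hθ).trans σ.toRingEquiv).trans (sepClosureEquiv θ hθ).symm)
    fun x => by
      apply (sepClosureEquiv θ hθ).injective
      change sepClosureEquiv θ hθ ((sepClosureEquiv θ hθ).symm
        (σ (sepClosureEquiv θ hθ (algebraMap E _ x)))) = _
      rw [RingEquiv.apply_symm_apply, sepClosureEquiv_algebraMap, σ.commutes]

theorem conjAbsGal_spec (θ : E →+* E) (hθ : Function.Surjective θ) (σ : AbsGal E)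
    (x : SeparableClosure E) :
    sepClosureEquiv θ hθ (conjAbsGal θ hθ σ x) = σ (sepClosureEquiv θ hθ x) :=
  (sepClosureEquiv θ hθ).apply_symm_apply _

/-- An automorphism of `E` over `F` is induced by an element `g` of the Galois group of `F`. -/
theorem exists_absGal_of_automorphism {f : F →+* E} (hf : Function.Surjective (sepClosureLift f))
    (θ : E →+* E) (hθ : Function.Surjective θ) (hθf : ∀ x, θ (f x) = f x) :
    ∃ g : AbsGal F, (∀ z, sepClosureLift f (g z) = sepClosureEquiv θ hθ (sepClosureLift f z)) ∧
      ∀ σ, g * galoisMap f (conjAbsGal θ hθ σ) = galoisMap f σ * g := by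
  obtain ⟨g, hg⟩ := exists_absGal_of_lifts (f := f) (sepClosureLift f)
    ((sepClosureEquiv θ hθ : SeparableClosure E →+* SeparableClosure E).comp (sepClosureLift f))
    (sepClosureLift_algebraMap f)
    (fun x => by
      rw [RingHom.comp_apply, sepClosureLift_algebraMap]
      exact (sepClosureEquiv_algebraMap θ hθ _).trans (by rw [hθf])) hf
    ((sepClosureEquiv θ hθ).surjective.comp hf)
  refine ⟨g, hg, fun σ => ?_⟩
  have hg' (z) : sepClosureLift f (g z) = sepClosureEquiv θ hθ (sepClosureLift f z) := hg z
  refine AlgEquiv.ext fun z => ?_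
  apply (sepClosureLift f).injective
  rw [AlgEquiv.mul_apply, AlgEquiv.mul_apply, hg', galoisMap_spec, galoisMap_spec, hg',
    conjAbsGal_spec]

/-- The range consists of the elements fixing `E`, and `u` generates `E` over `F`. The factor `c` is
allowed because the chosen embedding need not send a given root to `u` itself; lying in `f.range`,
it does not affect the condition. -/
theorem IsKummer.mem_range_galoisMap {f : F →+* E} {r : ℕ} {t : F} {u : E}
    (h : IsKummer f r t u) {s : SeparableClosure F} {c : E}
    (hs : sepClosureLift f s = algebraMap E _ (c * u)) (hc : c ≠ 0) (hcf : c ∈ f.range)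
    (g : AbsGal F) : g ∈ (galoisMap f).range ↔ g s = s := by
  have hsurj := h.sepClosureLift_surjective
  constructor
  · rintro ⟨σ, rfl⟩
    apply (sepClosureLift f).injective
    rw [galoisMap_spec, hs, σ.commutes]
  · intro hg
    obtain ⟨b, rfl⟩ := hcf
    let e := RingEquiv.ofBijective (sepClosureLift f) ⟨(sepClosureLift f).injective, hsurj⟩
    have he (z) : e.symm (sepClosureLift f z) = z := e.symm_apply_apply z
    have he' (z) : e z = sepClosureLift f z := rfl
    have hf (x : F) : e (g (e.symm (algebraMap E _ (f x)))) = algebraMap E _ (f x) := by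
      rw [← sepClosureLift_algebraMap, he, g.commutes, he']
    have hcu : e (g (e.symm (algebraMap E _ (f b * u)))) = algebraMap E _ (f b * u) := by
      rw [← hs, he, hg, he']
    have hu : e (g (e.symm (algebraMap E _ u))) = algebraMap E _ u := by
      rw [map_mul, map_mul, map_mul, map_mul, hf] at hcu
      exact mul_left_cancel₀ (by simpa using hc) hcu
    let σ : AbsGal E := AlgEquiv.ofRingEquiv (f := (e.symm.trans g.toRingEquiv).trans e) fun x => by
      change e (g (e.symm (algebraMap E _ x))) = _
      obtain ⟨a, rfl⟩ := h.exists_eq_sum x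
      simp only [map_sum, map_mul, map_pow, hf, hu]
    refine ⟨σ, galoisMap_eq_of_forall fun x => ?_⟩
    change _ = e (g (e.symm (sepClosureLift f x)))
    rw [he]
    rfl

/-- The Artin-Schreier cocycle does not depend on the choice of the root. -/
theorem primeFieldHom_artinSchreierDiff {p : ℕ} [Fact p.Prime] [Algebra (ZMod p) F] {a : F}
    {y : SeparableClosure F} (hy : y ^ p - y = algebraMap F _ a) (σ : AbsGal F) :
    primeFieldHom p F (artinSchreierDiff a σ) = σ y - y := by
  have : CharP (SeparableClosure F) p :=
    charP_of_injective_ringHom (primeFieldHom p F).injective p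
  set z := artinSchreierRoot p a with hz
  have h3 : (y - z) ^ p = y - z := by
    have : ExpChar (SeparableClosure F) p := ExpChar.prime Fact.out
    rw [sub_pow_char]
    linear_combination hy - artinSchreierRoot_spec p a
  have h4 : σ (y - z) = y - z := by
    -- The difference of two roots is fixed by Frobenius, so it lies in the prime field, which `σ`
    -- fixes.
    have h5 : y - z ∈ (⊥ : Subfield (SeparableClosure F)) :=
      (Subfield.mem_bot_iff_pow_eq_self _ p).2 h3
    exact (bot_le : ⊥ ≤ (σ : SeparableClosure F →+* SeparableClosure F).eqLocusField
      (RingHom.id _)) h5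
  rw [artinSchreierDiff_spec, ← hz]
  rw [map_sub] at h4
  linear_combination -h4

/-- The Artin-Schreier cocycle is functorial. -/
theorem artinSchreierDiff_eq {p : ℕ} [Fact p.Prime] [Algebra (ZMod p) F] [Algebra (ZMod p) E]
    {f : F →+* E} (i : SeparableClosure F →+* SeparableClosure E)
    (hi : ∀ x, i (algebraMap F _ x) = algebraMap E _ (f x)) (a : F) {τ : AbsGal F} {σ : AbsGal E}
    (h : ∀ z, i (τ z) = σ (i z)) :
    artinSchreierDiff (p := p) a τ = artinSchreierDiff (f a) σ := by
  have hprime (n : ZMod p) : i (primeFieldHom p F n) = primeFieldHom p E n :=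
    RingHom.congr_fun (RingHom.ext_zmod (i.comp (primeFieldHom p F)) (primeFieldHom p E)) n
  have h1 : i (artinSchreierRoot p a) ^ p - i (artinSchreierRoot p a)
      = algebraMap E _ (f a) := by
    rw [← hi, ← artinSchreierRoot_spec p a, map_sub, map_pow]
  apply (primeFieldHom p E).injective
  rw [primeFieldHom_artinSchreierDiff h1, ← hprime, artinSchreierDiff_spec, map_sub, h]

theorem artinSchreierDiff_add {p : ℕ} [Fact p.Prime] [Algebra (ZMod p) F] (a b : F)
    (σ : AbsGal F) : artinSchreierDiff (p := p) (a + b) σ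
      = artinSchreierDiff a σ + artinSchreierDiff b σ := by
  have : CharP (SeparableClosure F) p :=
    charP_of_injective_ringHom (primeFieldHom p F).injective p
  have h : (artinSchreierRoot p a + artinSchreierRoot p b) ^ p
      - (artinSchreierRoot p a + artinSchreierRoot p b) = algebraMap F _ (a + b) := by
    have : ExpChar (SeparableClosure F) p := ExpChar.prime Fact.out
    rw [add_pow_char, map_add]
    linear_combination artinSchreierRoot_spec p a + artinSchreierRoot_spec p b
  apply (primeFieldHom p F).injective
  rw [primeFieldHom_artinSchreierDiff h, map_add, map_add (primeFieldHom p F),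
    artinSchreierDiff_spec, artinSchreierDiff_spec]
  ring

end KummerExtension

/-! ### Henselian rings and tame extensions of `k⟦X⟧` -/

section TameExtension

/-- For finite `M`, the completion of `R` tensored with `M` surjects onto the completion of `M`;
scalars in the completion of `R` come from `R`. -/
theorem isPrecomplete_of_finite {R M : Type*} [CommRing R] (I : Ideal R) [IsPrecomplete I R]
    [AddCommGroup M] [Module R M] [Module.Finite R M] : IsPrecomplete I M := by
  rw [← AdicCompletion.of_surjective_iff]
  intro z
  obtain ⟨t, rfl⟩ := AdicCompletion.ofTensorProduct_surjective_of_finite I M z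
  change _ ∈ LinearMap.range (AdicCompletion.of I M)
  induction t with
  | zero => simp
  | add x y hx hy => rw [map_add]; exact add_mem hx hy
  | tmul x y =>
    obtain ⟨a, rfl⟩ := AdicCompletion.of_surjective I R x
    refine ⟨a • y, ?_⟩
    rw [AdicCompletion.ofTensorProduct_tmul, map_smul]
    ext n
    rfl

theorem henselianRing_map {R S : Type*} [CommRing R] [IsDomain R] [IsNoetherianRing R]
    [CommRing S] [Algebra R S] [Module.Finite R S] [Module.IsTorsionFree R S] (I : Ideal R)
    (hI : I ≠ ⊤) [IsPrecomplete I R] : HenselianRing S (I.map (algebraMap R S)) := by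
  have : IsPrecomplete I S := isPrecomplete_of_finite I
  have : IsHausdorff I S := IsHausdorff.of_isTorsionFree I S hI
  have : IsAdicComplete I S := {}
  have : IsAdicComplete (I.map (algebraMap R S)) S :=
    (IsAdicComplete.map_algebraMap_iff I S).2 this
  infer_instance

/-- Idempotents lift along `S → S / J` if `S` is henselian at `J`. -/
theorem mem_or_of_henselianRing {S : Type*} [CommRing S] [IsDomain S] (J : Ideal S)
    [HenselianRing S J] {x y : S} (hxy : x + y = 1) (h : x * y ∈ J) : x ∈ J ∨ y ∈ J := by
  -- Modulo `J`, `y` is a root of `X² - X` and the derivative `2y - 1` has square `1`. In a domain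
  -- the lifted root is `0` or `1`.
  obtain ⟨z, hz, hzy⟩ := HenselianRing.is_henselian (I := J)
    (Polynomial.X ^ 2 - Polynomial.X : Polynomial S)
    (by
      apply Polynomial.monic_X_pow_sub
      rw [Polynomial.degree_X]
      norm_num) y
    (by
      have : x * y = -(y ^ 2 - y) := by rw [eq_sub_of_add_eq hxy]; ring
      rw [this, neg_mem_iff] at h
      simpa using h)
    (by
      rw [isUnit_iff_exists_inv]
      refine ⟨Ideal.Quotient.mk J (2 * y - 1), ?_⟩
      rw [← map_mul, ← map_one (Ideal.Quotient.mk J), Ideal.Quotient.eq]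
      have : (2 * y - 1) * (2 * y - 1) - 1 = (-4) * (x * y) := by
        rw [eq_sub_of_add_eq hxy]; ring
      simp only [Polynomial.derivative_sub, Polynomial.derivative_X_pow, Polynomial.derivative_X,
        Polynomial.eval_sub, Polynomial.eval_one, Polynomial.eval_mul, Polynomial.eval_pow,
        Polynomial.eval_X, Polynomial.eval_C]
      norm_num
      rw [this]
      exact J.mul_mem_left _ h)
  have hz' : z * (z - 1) = 0 := by
    simp only [Polynomial.IsRoot, Polynomial.eval_sub, Polynomial.eval_pow,
      Polynomial.eval_X] at hz
    linear_combination hz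
  rcases mul_eq_zero.1 hz' with rfl | h1
  · right
    simpa using hzy
  · left
    rwa [sub_eq_zero.1 h1, ← hxy, add_sub_cancel_right] at hzy

/-- If `P ≠ Q`, write `J = P^a * C` with `C` prime to `P`, so that `C ≤ Q`. A decomposition `1 = x +
y` with `x ∈ P^a`, `y ∈ C` is then a nontrivial idempotent modulo `J`, which cannot exist. -/
theorem eq_of_henselianRing {S : Type*} [CommRing S] [IsDedekindDomain S]
    (J : Ideal S) (hJ : J ≠ ⊥) [HenselianRing S J] (P Q : Ideal S) [hP : P.IsMaximal]
    [hQ : Q.IsMaximal] (hJP : J ≤ P) (hJQ : J ≤ Q) : P = Q := by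
  by_contra hne
  obtain ⟨C, hC, hJC⟩ := Ideal.eq_prime_pow_mul_coprime hJ P
  set a := (UniqueFactorizationMonoid.normalizedFactors J).count P
  have ha : a ≠ 0 := by
    intro ha
    rw [ha, pow_zero, one_mul] at hJC
    rw [← hJC, sup_eq_left.2 hJP] at hC
    exact hP.ne_top hC
  have hCQ : C ≤ Q := by
    have h1 : P ^ a * C ≤ Q := hJC ▸ hJQ
    rcases hQ.isPrime.mul_le.1 h1 with h | h
    · exact absurd (hP.eq_of_le hQ.ne_top (hQ.isPrime.le_of_pow_le h)) hne
    · exact h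
  have hPC : P ^ a ⊔ C = ⊤ := Ideal.isCoprime_iff_sup_eq.1 (Ideal.isCoprime_iff_sup_eq.2 hC).pow_left
  obtain ⟨x, hx, y, hy, hxy⟩ := Submodule.mem_sup.1 (hPC ▸ Submodule.mem_top : (1 : S) ∈ P ^ a ⊔ C)
  have hxyJ : x * y ∈ J := by rw [hJC]; exact Ideal.mul_mem_mul hx hy
  rcases mem_or_of_henselianRing J hxy hxyJ with h | h
  · exact hQ.ne_top ((Ideal.eq_top_iff_one _).2 (hxy ▸ add_mem (hJQ h) (hCQ hy)))
  · exact hP.ne_top ((Ideal.eq_top_iff_one _).2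
      (hxy ▸ add_mem (Ideal.pow_le_self ha hx) (hJP h)))

theorem isLocalRing_of_henselianRing {S : Type*} [CommRing S] [IsDedekindDomain S]
    (J : Ideal S) (hJ : J ≠ ⊥) [HenselianRing S J] : IsLocalRing S := by
  have hmax (P : Ideal S) (hP : P.IsMaximal) : J ≤ P :=
    (HenselianRing.jac (I := J)).trans (sInf_le ⟨bot_le, hP⟩)
  obtain ⟨P, hP⟩ := Ideal.exists_maximal S
  exact .of_unique_max_ideal ⟨P, hP, fun Q hQ => eq_of_henselianRing J hJ Q P (hmax Q hQ) (hmax P hP)⟩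

/-- A principal unit has an `n`-th root in a henselian ring of characteristic `p`, if `p ∤ n`. -/
theorem exists_pow_eq_of_henselianRing {S : Type*} [CommRing S] (p : ℕ) [Fact p.Prime] [CharP S p]
    (J : Ideal S) [HenselianRing S J] {n : ℕ} (hn : ¬ p ∣ n) {w : S} (hw : IsUnit w) {N : ℕ}
    (hN : (w - 1) ^ p ^ N ∈ J) : ∃ z, z ^ n = w := by
  have hp : p.Prime := Fact.out
  have hn0 : n ≠ 0 := by rintro rfl; simp at hn
  -- The exponent `M + 1` keeps the modulus above `1`. The case `M = N` gives the approximate root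
  -- `w ^ a`, and `M = 0` gives the inverse of `n` in characteristic `p`.
  have hbez (M : ℕ) : ∃ a b : ℕ, n * a = 1 + p ^ (M + 1) * b := by
    have hcop : n.Coprime (p ^ (M + 1)) :=
      (((Nat.Prime.coprime_iff_not_dvd hp).2 hn).pow_left _).symm
    obtain ⟨a, -, ha⟩ := Nat.exists_mul_mod_eq_one_of_coprime hcop
      (Nat.one_lt_pow M.succ_ne_zero hp.one_lt)
    exact ⟨a, n * a / p ^ (M + 1), by
      have h := Nat.mod_add_div (n * a) (p ^ (M + 1))
      rw [ha] at h
      exact h.symm⟩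
  obtain ⟨a, b, hab⟩ := hbez N
  have hwN : w ^ p ^ (N + 1) - 1 ∈ J := by
    have : ExpChar S p := ExpChar.prime hp
    have h := J.pow_mem_of_mem hN p hp.pos
    rwa [← pow_mul, ← pow_succ, sub_pow_char_pow, one_pow] at h
  have hnS : IsUnit (n : S) := by
    obtain ⟨c, d, hcd⟩ := hbez 0
    have h := congrArg (Nat.cast : ℕ → S) hcd
    push_cast at h
    rw [CharP.cast_eq_zero S p] at h
    exact IsUnit.of_mul_eq_one (c : S) (by rw [h]; ring)
  obtain ⟨z, hz, -⟩ := HenselianRing.is_henselian (I := J)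
    (Polynomial.X ^ n - Polynomial.C w : Polynomial S) (Polynomial.monic_X_pow_sub_C w hn0) (w ^ a)
    (by
      have h1 : (w ^ p ^ (N + 1)) ^ b - 1 ∈ J := by
        exact J.mem_of_dvd (sub_one_dvd_pow_sub_one _ b) hwN
      have h2 : (w ^ a) ^ n - w = w * ((w ^ p ^ (N + 1)) ^ b - 1) := by
        rw [← pow_mul, mul_comm a, hab, pow_add, pow_mul]
        ring
      simp only [Polynomial.eval_sub, Polynomial.eval_pow, Polynomial.eval_X, Polynomial.eval_C]
      rw [h2]
      exact J.mul_mem_left _ h1)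
    (by
      simp only [Polynomial.derivative_sub, Polynomial.derivative_X_pow, Polynomial.derivative_C,
        sub_zero, Polynomial.eval_mul, Polynomial.eval_pow, Polynomial.eval_X, Polynomial.eval_C]
      exact (hnS.mul ((hw.pow a).pow _)).map _)
  refine ⟨z, ?_⟩
  simpa [Polynomial.IsRoot, sub_eq_zero] using hz

theorem isAlgClosed_residueField_powerSeries (k : Type*) [Field k] [IsAlgClosed k] :
    IsAlgClosed (IsLocalRing.ResidueField k⟦X⟧) :=
  IsAlgClosed.of_ringEquiv k _ PowerSeries.residueFieldOfPowerSeries.symm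

/-- Over an algebraically closed residue field, a tamely ramified extension of `k⟦X⟧` of degree `n`
contains an `n`-th root of `X`. -/
theorem exists_pow_finrank_eq_X {k : Type*} [Field k] [IsAlgClosed k] (p : ℕ) [Fact p.Prime]
    [CharP k p] (B : Type*) [CommRing B] [IsDedekindDomain B] [Algebra k⟦X⟧ B]
    [Module.Finite k⟦X⟧ B] [Module.IsTorsionFree k⟦X⟧ B]
    (hB : ∀ Q ∈ (IsLocalRing.maximalIdeal k⟦X⟧).primesOver B, ¬ p ∣ Q.ramificationIdx k⟦X⟧) :
    ¬ p ∣ Module.finrank k⟦X⟧ B ∧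
      ∃ s : B, s ^ Module.finrank k⟦X⟧ B = algebraMap k⟦X⟧ B PowerSeries.X := by
  set m := IsLocalRing.maximalIdeal k⟦X⟧ with hm
  set n := Module.finrank k⟦X⟧ B with hn
  set J := m.map (algebraMap k⟦X⟧ B) with hJdef
  have hinj : Function.Injective (algebraMap k⟦X⟧ B) := FaithfulSMul.algebraMap_injective _ _
  have hmX : m = Ideal.span {PowerSeries.X} := PowerSeries.maximalIdeal_eq_span_X
  have hJX : J = Ideal.span {algebraMap k⟦X⟧ B PowerSeries.X} := by
    rw [hJdef, hmX, Ideal.map_span, Set.image_singleton]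
  have hX0 : algebraMap k⟦X⟧ B PowerSeries.X ≠ 0 := by
    rw [Ne, map_eq_zero_iff _ hinj]
    exact PowerSeries.X_ne_zero
  have hJ : J ≠ ⊥ := by rwa [hJX, Ne, Ideal.span_singleton_eq_bot]
  have : IsPrecomplete m k⟦X⟧ := by rw [hmX]; infer_instance
  have : HenselianRing B J := henselianRing_map m (Ideal.IsPrime.ne_top inferInstance)
  have : IsLocalRing B := isLocalRing_of_henselianRing J hJ
  set Q := IsLocalRing.maximalIdeal B with hQ
  have hlies : Q.LiesOver m :=
    ⟨(IsLocalRing.eq_maximalIdeal (Ideal.isMaximal_comap_of_isIntegral_of_isMaximal Q)).symm⟩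
  have huniq (P : Ideal B) (hP : P ∈ m.primesOver B) : P = Q := by
    have hJP : J ≤ P := Ideal.map_le_iff_le_comap.2 hP.2.over.le
    exact IsLocalRing.eq_maximalIdeal (hP.1.isMaximal (ne_bot_of_le_ne_bot hJ hJP))
  -- The residue field is algebraically closed, so it does not grow; hence the extension is totally
  -- ramified.
  have hsurj : Function.Surjective (algebraMap (k⟦X⟧ ⧸ m) (B ⧸ Q)) := by
    let := Ideal.Quotient.field m
    have : IsAlgClosed (k⟦X⟧ ⧸ m) := isAlgClosed_residueField_powerSeries k
    exact IsAlgClosed.algebraMap_bijective_of_isIntegral.2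
  have hinertia : Q.inertiaDeg k⟦X⟧ = 1 := by
    let := Ideal.Quotient.field m
    rw [Ideal.inertiaDeg_eq_of_isMaximal m Q, finrank_eq_one_iff_of_nonzero' 1 one_ne_zero]
    intro y
    obtain ⟨x, rfl⟩ := hsurj y
    exact ⟨x, (Algebra.algebraMap_eq_smul_one x).symm⟩
  have hram : Q.ramificationIdx k⟦X⟧ = n := by
    let : Unique (m.primesOver B) :=
      { default := ⟨Q, inferInstance, hlies⟩
        uniq := fun P => Subtype.ext (huniq P P.2) }
    have h := Ideal.sum_ramification_inertia_eq_finrank m B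
    rw [Fintype.sum_unique] at h
    rw [hn, ← h]
    change _ = Q.ramificationIdx k⟦X⟧ * Q.inertiaDeg k⟦X⟧
    rw [hinertia, mul_one]
  have hJQ : J = Q ^ n := by
    have hT : IsDedekindDomain B ↔ ∀ I : Ideal B, I ≠ ⊥ → ∃ e : ℕ, I = Q ^ e :=
      (tfae_of_isNoetherianRing_of_isLocalRing_of_isDomain B).out 2 6
    obtain ⟨e, he⟩ := hT.1 inferInstance J hJ
    have hQ0 : Q ≠ ⊥ := ne_bot_of_le_ne_bot hJ (Ideal.map_le_iff_le_comap.2 hlies.over.le)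
    rw [← hram, Ideal.IsDedekindDomain.ramificationIdx_eq_normalizedFactors_count m Q hJ]
    change J = Q ^ (UniqueFactorizationMonoid.normalizedFactors J).count Q
    have hirr : Irreducible Q := (Ideal.prime_of_isPrime hQ0 inferInstance).irreducible
    have : (UniqueFactorizationMonoid.normalizedFactors J).count Q = e := by
      rw [he, UniqueFactorizationMonoid.normalizedFactors_pow,
        UniqueFactorizationMonoid.normalizedFactors_irreducible hirr]
      simp
    rw [this, he]
  refine ⟨hram ▸ hB Q ⟨inferInstance, hlies⟩, ?_⟩
  obtain ⟨π, hπ⟩ : ∃ π, Q = Ideal.span {π} := by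
    have hT : IsDedekindDomain B ↔ IsPrincipalIdealRing B :=
      (tfae_of_isNoetherianRing_of_isLocalRing_of_isDomain B).out 2 0
    have : IsPrincipalIdealRing B := hT.1 inferInstance
    exact (IsPrincipalIdealRing.principal Q).principal
  obtain ⟨v, hv⟩ : ∃ v : Bˣ, π ^ n * v = algebraMap k⟦X⟧ B PowerSeries.X := by
    rw [hJX, hπ, Ideal.span_singleton_pow, Ideal.span_singleton_eq_span_singleton] at hJQ
    exact hJQ.symm
  have hn0 : n ≠ 0 := hram ▸ (Ideal.ramificationIdx_pos Q k⟦X⟧).ne'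
  have hpn : ¬ p ∣ n := hram ▸ hB Q ⟨inferInstance, hlies⟩
  obtain ⟨c, hc0, hc⟩ : ∃ c : k, c ≠ 0 ∧ algebraMap k⟦X⟧ B (PowerSeries.C c) - v ∈ Q := by
    obtain ⟨x, hx⟩ := hsurj (Ideal.Quotient.mk Q v)
    obtain ⟨x, rfl⟩ := Ideal.Quotient.mk_surjective x
    rw [Ideal.Quotient.algebraMap_mk_of_liesOver, Ideal.Quotient.eq] at hx
    have hmem : algebraMap k⟦X⟧ B (PowerSeries.C (PowerSeries.constantCoeff x)) - v ∈ Q := by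
      have h1 : PowerSeries.C (PowerSeries.constantCoeff x) - x ∈ m := by
        rw [hmX, Ideal.mem_span_singleton, PowerSeries.X_dvd_iff]
        simp
      have h2 := Ideal.map_le_iff_le_comap.2 hlies.over.le (Ideal.mem_map_of_mem _ h1)
      rw [map_sub] at h2
      simpa using add_mem h2 hx
    refine ⟨_, fun h0 => ?_, hmem⟩
    rw [h0, map_zero, map_zero, zero_sub, neg_mem_iff] at hmem
    exact (IsLocalRing.mem_maximalIdeal _).1 hmem v.isUnit
  obtain ⟨b, hb⟩ := IsAlgClosed.exists_pow_nat_eq c (Nat.pos_of_ne_zero hn0)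
  have hb0 : b ≠ 0 := by
    rintro rfl
    exact hc0 (by rw [← hb, zero_pow hn0])
  let j : k →+* B := (algebraMap k⟦X⟧ B).comp PowerSeries.C
  have : CharP B p := charP_of_injective_ringHom j.injective p
  have hbn : j b ^ n = algebraMap k⟦X⟧ B (PowerSeries.C c) := by
    rw [← map_pow, hb]
    rfl
  have hbinv : j b * j b⁻¹ = 1 := by
    rw [← map_mul, mul_inv_cancel₀ hb0, map_one]
  have hbinvn : j b ^ n * j b⁻¹ ^ n = 1 := by
    rw [← mul_pow, hbinv, one_pow]
  -- Dividing the unit `v` by `b ^ n`, with the same residue, leaves a principal unit. It is `1`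
  -- only modulo `Q`, but `n < p ^ n` puts the `p ^ n`-th power of the difference into `Q ^ n = J`.
  obtain ⟨z, hz⟩ := exists_pow_eq_of_henselianRing p J hpn (w := v * j b⁻¹ ^ n) (N := n)
    (v.isUnit.mul ((IsUnit.of_mul_eq_one (j b) (by rw [mul_comm, hbinv])).pow n)) (by
      have h1 : (v : B) * j b⁻¹ ^ n - 1 ∈ Q := by
        have h2 : (v : B) * j b⁻¹ ^ n - 1 = -(j b⁻¹ ^ n) * (j b ^ n - v) := by
          linear_combination hbinvn
        rw [h2, hbn]
        exact Q.mul_mem_left _ hc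
      rw [hJQ]
      exact Ideal.pow_le_pow_right (Nat.lt_pow_self (Fact.out : p.Prime).one_lt).le
        (Ideal.pow_mem_pow h1 _))
  refine ⟨π * j b * z, ?_⟩
  rw [mul_pow, mul_pow, hz, ← hv]
  linear_combination (π ^ n * v) * hbinvn

end TameExtension

/-! ### Roots of the coordinate, wild inertia and Kummer characters -/

section Disc

variable {k : Type u} [Field k]

theorem order_coord : (coord k).order = 1 := by
  rw [coord, HahnSeries.order_single one_ne_zero]

/-- An `n`-th root of the coordinate generates an extension of degree at least `n`. -/
theorem dvd_finrank_adjoin_root {L : Type*} [Field L] [Algebra k⸨X⸩ L] {n : ℕ} {s : L}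
    (hs : s ^ n = algebraMap k⸨X⸩ L (coord k)) :
    n ∣ Module.finrank k⸨X⸩ (IntermediateField.adjoin k⸨X⸩ {s}) := by
  have h : (IntermediateField.AdjoinSimple.gen k⸨X⸩ s) ^ n
      = algebraMap k⸨X⸩ (IntermediateField.adjoin k⸨X⸩ {s}) (coord k) := by
    apply (algebraMap (IntermediateField.adjoin k⸨X⸩ {s}) L).injective
    rw [map_pow, IntermediateField.AdjoinSimple.algebraMap_gen, hs,
      ← IsScalarTower.algebraMap_apply]
  -- The norm of the coordinate has order equal to the degree, while the norm of `s ^ n` has order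
  -- divisible by `n`.
  have h1 := congrArg HahnSeries.order (congrArg (Algebra.norm k⸨X⸩) h)
  rw [map_pow, Algebra.norm_algebraMap, HahnSeries.order_pow, HahnSeries.order_pow,
    order_coord] at h1
  simp only [nsmul_eq_mul, mul_one] at h1
  exact_mod_cast (Dvd.intro _ h1 : (n : ℤ) ∣ _)

/-- The ring of integers of `L` contains a root `s` of the coordinate of exponent `[L : K]`, and
such a root already generates a subfield of that degree. -/
theorem exists_root_of_isTamelyRamified (p : ℕ) [Fact p.Prime] [IsAlgClosed k] [CharP k p]
    {L : IntermediateField k⸨X⸩ (SeparableClosure k⸨X⸩)} (hL : IsTamelyRamified p L) :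
    ∃ n, ¬ p ∣ n ∧ ∃ s, s ^ n = algebraMap k⸨X⸩ (SeparableClosure k⸨X⸩) (coord k) ∧
      L = IntermediateField.adjoin k⸨X⸩ {s} := by
  have := hL.finite
  have : Algebra.IsSeparable k⸨X⸩ L := inferInstance
  have : IsDedekindDomain (integralClosure k⟦X⟧ L) := integralClosure.isDedekindDomain k⟦X⟧ k⸨X⸩ L
  have : Module.Finite k⟦X⟧ (integralClosure k⟦X⟧ L) :=
    IsIntegralClosure.finite k⟦X⟧ k⸨X⸩ L (integralClosure k⟦X⟧ L)
  have : IsFractionRing (integralClosure k⟦X⟧ L) L :=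
    integralClosure.isFractionRing_of_finite_extension k⸨X⸩ L
  have : Module.IsTorsionFree k⟦X⟧ (integralClosure k⟦X⟧ L) := by
    rw [Module.isTorsionFree_iff_algebraMap_injective]
    have h : Function.Injective (algebraMap k⟦X⟧ L) := by
      rw [IsScalarTower.algebraMap_eq k⟦X⟧ k⸨X⸩ L]
      exact (algebraMap k⸨X⸩ L).injective.comp (IsFractionRing.injective k⟦X⟧ k⸨X⸩)
    rw [IsScalarTower.algebraMap_eq k⟦X⟧ (integralClosure k⟦X⟧ L) L, RingHom.coe_comp] at h
    exact h.of_comp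
  obtain ⟨hp, s, hs⟩ := exists_pow_finrank_eq_X p (integralClosure k⟦X⟧ L) hL.not_dvd
  have hfr : Module.finrank k⟦X⟧ (integralClosure k⟦X⟧ L) = Module.finrank k⸨X⸩ L := by
    exact (IsFractionRing.finrank_eq k⟦X⟧ k⸨X⸩ (integralClosure k⟦X⟧ L) L).symm
  rw [hfr] at hp hs
  have hs' : (((s : L) : SeparableClosure k⸨X⸩)) ^ Module.finrank k⸨X⸩ L
      = algebraMap k⸨X⸩ (SeparableClosure k⸨X⸩) (coord k) := by
    have h1 := congrArg (fun x : integralClosure k⟦X⟧ L => ((x : L) : SeparableClosure k⸨X⸩)) hs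
    have h2 : algebraMap k⟦X⟧ k⸨X⸩ PowerSeries.X = coord k := by simp [coord]
    have h3 : ((algebraMap k⟦X⟧ L PowerSeries.X : L) : SeparableClosure k⸨X⸩)
        = algebraMap k⸨X⸩ _ (coord k) := by
      rw [IsScalarTower.algebraMap_apply k⟦X⟧ k⸨X⸩ L, h2]
      rfl
    simpa using h1.trans h3
  refine ⟨_, hp, _, hs', ?_⟩
  symm
  refine IntermediateField.eq_of_le_of_finrank_le ?_ ?_
  · rw [IntermediateField.adjoin_simple_le_iff]
    exact (s : L).2
  · have : FiniteDimensional k⸨X⸩ (IntermediateField.adjoin k⸨X⸩ {((s : L) : SeparableClosure k⸨X⸩)}) :=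
      IntermediateField.adjoin.finiteDimensional (Algebra.IsIntegral.isIntegral _)
    exact Nat.le_of_dvd Module.finrank_pos (dvd_finrank_adjoin_root hs')

theorem mem_wildInertia_of_forall (p : ℕ) [Fact p.Prime] [IsAlgClosed k] [CharP k p]
    {σ : AbsGal k⸨X⸩}
    (hσ : ∀ n, ¬ p ∣ n → ∀ s, s ^ n = algebraMap k⸨X⸩ (SeparableClosure k⸨X⸩) (coord k) → σ s = s) :
    σ ∈ wildInertia p k := by
  -- The compositum lies in the fixed field of `σ` as soon as each generator does.
  have h : tameClosure p k ≤ IntermediateField.fixedField (Subgroup.zpowers σ) := by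
    refine iSup₂_le fun L hL => ?_
    obtain ⟨n, hn, s, hs, rfl⟩ := exists_root_of_isTamelyRamified p hL
    rw [IntermediateField.adjoin_simple_le_iff, IntermediateField.mem_fixedField_iff]
    intro τ hτ
    have h : Subgroup.zpowers σ ≤ MulAction.stabilizer (AbsGal k⸨X⸩) s :=
      Subgroup.zpowers_le.2 (hσ n hn s hs)
    exact h hτ
  rw [IntermediateField.le_iff_le] at h
  exact h (Subgroup.mem_zpowers σ)

/-- The embedding of the field of constants. -/
noncomputable def constHom (k : Type u) [Field k] : k →+* SeparableClosure k⸨X⸩ :=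
  (algebraMap k⸨X⸩ (SeparableClosure k⸨X⸩)).comp HahnSeries.C

theorem algebraMap_C (c : k) :
    algebraMap k⸨X⸩ (SeparableClosure k⸨X⸩) (HahnSeries.C c) = constHom k c := rfl

theorem absGal_constHom (σ : AbsGal k⸨X⸩) (c : k) : σ (constHom k c) = constHom k c :=
  σ.commutes _

theorem lift_constHom {f : k⸨X⸩ →+* k⸨X⸩} (hf : ∀ c, f (HahnSeries.C c) = HahnSeries.C c)
    {i : SeparableClosure k⸨X⸩ →+* SeparableClosure k⸨X⸩}
    (hi : ∀ x, i (algebraMap k⸨X⸩ _ x) = algebraMap k⸨X⸩ _ (f x)) (c : k) :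
    i (constHom k c) = constHom k c := by
  rw [← algebraMap_C, hi, hf]

theorem isKummer_powMap (p : ℕ) [Fact p.Prime] [CharP k p] {r : ℕ} (hr : ¬ p ∣ r) :
    IsKummer (powMap k r) r (coord k) (coord k) := by
  have hr0 : 0 < r := Nat.pos_of_ne_zero (by rintro rfl; simp at hr)
  have : CharP k⸨X⸩ p :=
    charP_of_injective_ringHom (HahnSeries.C : k →+* k⸨X⸩).injective p
  exact ⟨coord_ne_zero, by rwa [Ne, CharP.cast_eq_zero_iff _ p], (powMap_coord hr0).symm,
    fun x => ⟨fun i => dissect r hr0 i x, eq_sum_dissect r hr0 x⟩⟩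

/-- Elements with the same `r`-th power differ by a power of the root of unity `ζ`. -/
theorem exists_eq_root_mul {ζ : k} {r : ℕ} [NeZero r] (hζ : IsPrimitiveRoot ζ r)
    {x y : SeparableClosure k⸨X⸩} (hy : y ≠ 0) (h : x ^ r = y ^ r) :
    ∃ i, x = constHom k (ζ ^ i) * y := by
  obtain ⟨i, -, hi⟩ := (hζ.map_of_injective (constHom k).injective).eq_pow_of_pow_eq_one
    (ξ := x / y) (by rw [div_pow, h, div_self (pow_ne_zero _ hy)])
  exact ⟨i, by rw [map_pow, hi, div_mul_cancel₀ _ hy]⟩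

theorem algebraMap_coord_ne_zero :
    algebraMap k⸨X⸩ (SeparableClosure k⸨X⸩) (coord k) ≠ 0 := by
  rw [Ne, map_eq_zero]
  exact coord_ne_zero

theorem root_ne_zero {s : SeparableClosure k⸨X⸩} {r : ℕ} [NeZero r]
    (hs : s ^ r = algebraMap k⸨X⸩ _ (coord k)) : s ≠ 0 := by
  rintro rfl
  rw [zero_pow (NeZero.ne r)] at hs
  exact algebraMap_coord_ne_zero hs.symm

/-- Both sides are `r`-th roots of `u ^ r`. The exponent `i` depends on the arbitrary choice of the
embedding. -/
theorem sepClosureLift_powMap_root {ζ : k} {r : ℕ} [NeZero r] (hζ : IsPrimitiveRoot ζ r)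
    {s : SeparableClosure k⸨X⸩} (hs : s ^ r = algebraMap k⸨X⸩ _ (coord k)) :
    ∃ i, sepClosureLift (powMap k r) s
      = algebraMap k⸨X⸩ _ (HahnSeries.C (ζ ^ i) * coord k) := by
  obtain ⟨i, hi⟩ := exists_eq_root_mul hζ algebraMap_coord_ne_zero
    (x := sepClosureLift (powMap k r) s) (by
      rw [← map_pow, hs, sepClosureLift_algebraMap, powMap_coord (NeZero.pos r), map_pow])
  exact ⟨i, by rw [hi, map_mul]; rfl⟩

theorem mem_range_galoisMap_powMap (p : ℕ) [Fact p.Prime] [CharP k p] {r : ℕ} (hr : ¬ p ∣ r)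
    {ζ : k} [NeZero r] (hζ : IsPrimitiveRoot ζ r)
    {s : SeparableClosure k⸨X⸩} (hs : s ^ r = algebraMap k⸨X⸩ _ (coord k)) (g : AbsGal k⸨X⸩) :
    g ∈ (galoisMap (powMap k r)).range ↔ g s = s := by
  obtain ⟨i, hi⟩ := sepClosureLift_powMap_root hζ hs
  refine (isKummer_powMap p hr).mem_range_galoisMap hi ?_ ⟨HahnSeries.C (ζ ^ i), ?_⟩ g
  · rw [Ne, map_eq_zero]
    exact pow_ne_zero _ (hζ.ne_zero (NeZero.ne r))
  · exact powMap_C (NeZero.pos r) _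

/-- Elements whose `n`-th powers differ by a constant differ by a constant. -/
theorem exists_eq_constHom_mul (p : ℕ) [Fact p.Prime] [IsAlgClosed k] [CharP k p] {n : ℕ}
    (hn : ¬ p ∣ n) {c : k} {x y : SeparableClosure k⸨X⸩} (hy : y ≠ 0)
    (h : x ^ n = constHom k c * y ^ n) : ∃ a, x = constHom k a * y := by
  have : NeZero n := ⟨by rintro rfl; simp at hn⟩
  have : NeZero (n : k) := ⟨by rwa [Ne, CharP.cast_eq_zero_iff k p]⟩
  obtain ⟨ζ, hζ⟩ := HasEnoughRootsOfUnity.exists_primitiveRoot k n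
  obtain ⟨b, rfl⟩ := IsAlgClosed.exists_pow_nat_eq c (NeZero.pos n)
  by_cases hb : b = 0
  · subst hb
    refine ⟨0, ?_⟩
    rw [zero_pow (NeZero.ne n), map_zero, zero_mul] at h
    rw [map_zero, zero_mul, eq_zero_of_pow_eq_zero h]
  · obtain ⟨i, hi⟩ := exists_eq_root_mul hζ (x := x) (y := constHom k b * y)
      (mul_ne_zero (by simpa using hb) hy) (by rw [mul_pow, ← map_pow, h])
    exact ⟨ζ ^ i * b, by rw [hi, map_mul, mul_assoc]⟩

/-- The Kummer character `g ↦ g s / s` attached to an `r`-th root `s` of the coordinate. -/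
theorem exists_kummerChar {ζ : k} {r : ℕ} [NeZero r] (hζ : IsPrimitiveRoot ζ r)
    {s : SeparableClosure k⸨X⸩} (hs : s ^ r = algebraMap k⸨X⸩ _ (coord k)) :
    ∃ e : AbsGal k⸨X⸩ →* Multiplicative (ZMod r), ∀ (g : AbsGal k⸨X⸩) (n : ℕ),
      e g = Multiplicative.ofAdd (n : ZMod r) ↔ g s = constHom k (ζ ^ n) * s := by
  have hs0 := root_ne_zero hs
  have hex (g : AbsGal k⸨X⸩) : ∃ i, g s = constHom k (ζ ^ i) * s :=
    exists_eq_root_mul hζ hs0 (by rw [← map_pow, hs, g.commutes])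
  choose i hi using hex
  have key (g : AbsGal k⸨X⸩) (n : ℕ) :
      Multiplicative.ofAdd (i g : ZMod r) = Multiplicative.ofAdd (n : ZMod r)
        ↔ g s = constHom k (ζ ^ n) * s := by
    obtain ⟨c, rfl⟩ := hζ.isUnit (NeZero.ne r)
    rw [hi, mul_left_inj' hs0, (constHom k).injective.eq_iff, Multiplicative.ofAdd.injective.eq_iff,
      ZMod.natCast_eq_natCast_iff, (IsPrimitiveRoot.coe_units_iff.1 hζ).eq_orderOf,
      ← pow_eq_pow_iff_modEq, ← Units.val_pow_eq_pow_val, ← Units.val_pow_eq_pow_val, Units.val_inj]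
  -- The cocycle is a homomorphism because the roots of unity are constants, fixed by the Galois
  -- group.
  refine ⟨MonoidHom.mk' (fun g => Multiplicative.ofAdd (i g : ZMod r)) fun g h => ?_, key⟩
  rw [← ofAdd_add, ← Nat.cast_add, key, AlgEquiv.mul_apply, hi h, map_mul, absGal_constHom, hi g,
    pow_add, map_mul]
  ring

/-- The automorphism `u ↦ c u` of `k((u))`, for `c ^ r = 1`, is induced by an element of the
absolute Galois group of `k((t))`, `t = u ^ r`. -/
theorem exists_absGal_rotate (p : ℕ) [Fact p.Prime] [CharP k p] {r : ℕ} (hr : ¬ p ∣ r)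
    {ζ : k} [NeZero r] (hζ : IsPrimitiveRoot ζ r)
    {s : SeparableClosure k⸨X⸩} (hs : s ^ r = algebraMap k⸨X⸩ _ (coord k)) {c : kˣ}
    (hc : c ^ r = 1) (hsurj : Function.Surjective (rotate c)) :
    ∃ g : AbsGal k⸨X⸩, g s = constHom k c * s ∧
      ∀ σ, g * galoisMap (powMap k r) (conjAbsGal (rotate c) hsurj σ)
        = galoisMap (powMap k r) σ * g := by
  obtain ⟨g, hg, hg'⟩ := exists_absGal_of_automorphism
    (isKummer_powMap p hr).sepClosureLift_surjective (rotate c) hsurj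
    (rotate_powMap (NeZero.pos r) hc)
  refine ⟨g, ?_, hg'⟩
  apply (sepClosureLift (powMap k r)).injective
  obtain ⟨i, hi⟩ := sepClosureLift_powMap_root hζ hs
  rw [hg, hi, sepClosureEquiv_algebraMap, map_mul, rotate_C, rotate_coord, map_mul (sepClosureLift _),
    lift_constHom (powMap_C (NeZero.pos r)) (sepClosureLift_algebraMap _), hi, ← algebraMap_C,
    ← map_mul]
  congr 1
  ring

theorem rotate_surjective (c : kˣ) : Function.Surjective (rotate c) :=
  fun x => ⟨_, rotate_rotate_inv c x⟩

theorem isUnit_of_isPrimitiveRoot {ζ : k} {r : ℕ} [NeZero r] (hζ : IsPrimitiveRoot ζ r) (n : ℕ) :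
    ∃ c : kˣ, (c : k) = ζ ^ n ∧ c ^ r = 1 := by
  refine ⟨(hζ.isUnit (NeZero.ne r)).unit ^ n, by simp, ?_⟩
  ext
  have h : (ζ ^ n) ^ r = 1 := by rw [← pow_mul, mul_comm, pow_mul, hζ.pow_eq_one, one_pow]
  simpa using h

/-- The range is the kernel of the Kummer character to `ℤ/r`, which is onto because every rotation
by a power of `ζ` lifts to a Galois element. -/
theorem index_range_galoisMap_powMap (p : ℕ) [Fact p.Prime] [CharP k p] {r : ℕ} (hr : ¬ p ∣ r)
    {ζ : k} (hζ : IsPrimitiveRoot ζ r) : (galoisMap (powMap k r)).range.index = r := by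
  have : NeZero r := ⟨by rintro rfl; simp at hr⟩
  have hsurj := (isKummer_powMap p hr (k := k)).sepClosureLift_surjective
  obtain ⟨s, hs⟩ := hsurj (algebraMap _ _ (coord k))
  have hs : s ^ r = algebraMap k⸨X⸩ _ (coord k) := by
    apply (sepClosureLift (powMap k r)).injective
    rw [map_pow, hs, sepClosureLift_algebraMap, powMap_coord (NeZero.pos r), map_pow]
  obtain ⟨e, he⟩ := exists_kummerChar hζ hs
  have hker : (galoisMap (powMap k r)).range = e.ker := by
    ext g
    rw [mem_range_galoisMap_powMap p hr hζ hs, MonoidHom.mem_ker]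
    have := he g 0
    simp only [Nat.cast_zero, ofAdd_zero, pow_zero, map_one, one_mul] at this
    exact this.symm
  have hrange : e.range = ⊤ := by
    refine MonoidHom.range_eq_top.2 fun x => ?_
    obtain ⟨c, hcn, hc⟩ := isUnit_of_isPrimitiveRoot hζ (Multiplicative.toAdd x).val
    obtain ⟨g, hg, -⟩ := exists_absGal_rotate p hr hζ hs hc (rotate_surjective c)
    rw [hcn] at hg
    refine ⟨g, ((he g _).2 hg).trans ?_⟩
    rw [ZMod.natCast_zmod_val]
    rfl
  rw [hker, Subgroup.index_ker, hrange, Subgroup.card_top]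
  exact Nat.card_zmod r

end Disc

/-! ### Rank one twists of tensor products -/

section Twist

variable (Λ V₁ V₂ : Type*) [Field Λ] [AddCommGroup V₁] [Module Λ V₁] [AddCommGroup V₂] [Module Λ V₂]

/-- The tensor product of two twists by rank one representations is the twist of the tensor
product. -/
noncomputable def twistEquiv : (Λ ⊗[Λ] V₁) ⊗[Λ] (Λ ⊗[Λ] V₂) ≃ₗ[Λ] Λ ⊗[Λ] (V₁ ⊗[Λ] V₂) :=
  (TensorProduct.tensorTensorTensorComm Λ Λ V₁ Λ V₂).trans
    (TensorProduct.congr (TensorProduct.lid Λ Λ) (LinearEquiv.refl Λ _))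

variable {Λ V₁ V₂}

theorem twistEquiv_comp_map (c₁ c₂ : Λ) (f₁ : V₁ →ₗ[Λ] V₁) (f₂ : V₂ →ₗ[Λ] V₂) :
    (twistEquiv Λ V₁ V₂).toLinearMap.comp
      (TensorProduct.map (TensorProduct.map (c₁ • LinearMap.id) f₁)
        (TensorProduct.map (c₂ • LinearMap.id) f₂))
    = (TensorProduct.map ((c₁ * c₂) • LinearMap.id) (TensorProduct.map f₁ f₂)).comp
        (twistEquiv Λ V₁ V₂).toLinearMap := by
  refine TensorProduct.ext_fourfold' fun a v b w => ?_
  simp only [twistEquiv, LinearMap.comp_apply, TensorProduct.map_tmul, LinearEquiv.coe_coe,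
    LinearEquiv.trans_apply, TensorProduct.tensorTensorTensorComm_tmul, TensorProduct.congr_tmul,
    TensorProduct.lid_tmul, LinearEquiv.refl_apply, LinearMap.smul_apply, LinearMap.id_apply,
    smul_eq_mul]
  congr 1
  ring

end Twist

/-! ### Composition of coverings and the effect of rotations on tame inertia -/

section Composition

variable {k : Type u} [Field k]

/-- The composite of the two chosen embeddings and the chosen embedding for `a * b` extend the same
map, so they differ by a Galois element. -/
theorem exists_conj_galoisMap_powMap (p : ℕ) [Fact p.Prime] [CharP k p] {a b : ℕ}
    (ha : ¬ p ∣ a) (hb : ¬ p ∣ b) :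
    ∃ x : AbsGal k⸨X⸩, ∀ σ, galoisMap (powMap k a) (galoisMap (powMap k b) σ) * x
      = x * galoisMap (powMap k (a * b)) σ := by
  have ha0 : 0 < a := Nat.pos_of_ne_zero (by rintro rfl; simp at ha)
  have hb0 : 0 < b := Nat.pos_of_ne_zero (by rintro rfl; simp at hb)
  have hab : ¬ p ∣ a * b := by
    rw [(Fact.out : p.Prime).dvd_mul]
    exact not_or.2 ⟨ha, hb⟩
  refine exists_conj_galoisMap (isKummer_powMap p hab).sepClosureLift_surjective
    ((sepClosureLift (powMap k b)).comp (sepClosureLift (powMap k a)))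
    ((isKummer_powMap p hb).sepClosureLift_surjective.comp
      (isKummer_powMap p ha).sepClosureLift_surjective) (fun x => ?_) _ fun σ z => ?_
  · rw [RingHom.comp_apply, sepClosureLift_algebraMap, sepClosureLift_algebraMap]
    exact congrArg _ (RingHom.congr_fun (powMap_comp hb0 ha0) x)
  · rw [RingHom.comp_apply, galoisMap_spec, galoisMap_spec]
    rfl

/-- The automorphisms `u ↦ c u` act trivially on the tame quotient of the Galois group. -/
theorem galoisMap_conjAbsGal_mem_wildInertia (p : ℕ) [Fact p.Prime] [IsAlgClosed k] [CharP k p]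
    {b : ℕ} (hb : 0 < b) (c : kˣ) (σ : AbsGal k⸨X⸩) :
    galoisMap (powMap k b) (conjAbsGal (rotate c) (rotate_surjective c) σ)
      * (galoisMap (powMap k b) σ)⁻¹ ∈ wildInertia p k := by
  refine mem_wildInertia_of_forall p fun n hn s hs => ?_
  have : NeZero n := ⟨by rintro rfl; simp at hn⟩
  set Θ := sepClosureEquiv (rotate c) (rotate_surjective c) with hΘ
  set w := sepClosureLift (powMap k b) s with hw
  have hw0 : w ≠ 0 := by
    rw [hw, Ne, map_eq_zero]
    exact root_ne_zero hs
  have hwn : w ^ n = algebraMap k⸨X⸩ _ (coord k ^ b) := by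
    rw [hw, ← map_pow, hs, sepClosureLift_algebraMap, powMap_coord hb]
  -- Both `σ⁻¹` and `Θ` multiply `w` by constants, and both fix constants; hence they commute on
  -- `w`.
  obtain ⟨x, hx⟩ := exists_eq_constHom_mul p hn (c := 1) (x := σ⁻¹ w) (y := w) hw0 (by
    rw [← map_pow, hwn, AlgEquiv.commutes, map_one, one_mul])
  obtain ⟨y, hy⟩ := exists_eq_constHom_mul p hn (c := (c : k) ^ b) (x := Θ w) (y := w) hw0 (by
    rw [← map_pow, hwn, hΘ, sepClosureEquiv_algebraMap, map_pow (rotate c), rotate_coord, mul_pow,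
      map_mul, ← map_pow HahnSeries.C, algebraMap_C])
  have hΘc (a : k) : Θ (constHom k a) = constHom k a := by
    rw [← algebraMap_C, hΘ, sepClosureEquiv_algebraMap, rotate_C]
  apply (sepClosureLift (powMap k b)).injective
  rw [← map_inv, ← map_mul, galoisMap_spec, ← hw, AlgEquiv.mul_apply]
  apply Θ.injective
  have h1 : w = constHom k x * σ w := by
    conv_lhs => rw [← AlgEquiv.apply_symm_apply σ w]
    change σ (σ⁻¹ w) = _
    rw [hx, map_mul, absGal_constHom]
  rw [hΘ, conjAbsGal_spec, ← hΘ, hx, map_mul, hΘc, hy, map_mul, map_mul, absGal_constHom,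
    absGal_constHom]
  conv_rhs => rw [h1]
  ring

end Composition

/-! ### Artin-Schreier twists -/

section Twist

variable {p : ℕ} [Fact p.Prime] {Λ V₁ V₂ : Type*} [Field Λ] [AddCommGroup V₁] [Module Λ V₁]
  [AddCommGroup V₂] [Module Λ V₂]

theorem tprod_artinSchreier_apply {F : Type*} [Field F] [Algebra (ZMod p) F]
    (ψ : AddChar (ZMod p) Λ) (ρ : Representation Λ (AbsGal F) V₁) (a : F) (σ : AbsGal F) :
    Representation.tprod (artinSchreier ψ a) ρ σ
      = TensorProduct.map (ψ (artinSchreierDiff a σ) • LinearMap.id) (ρ σ) :=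
  rfl

/-- This supplies the intertwining hypothesis of Mackey's formula: `ψ` turns the sum of the cocycles
into the product of the two scalars. -/
theorem twistEquiv_comp_tprod_artinSchreier {F E : Type*} [Field F] [Field E]
    [Algebra (ZMod p) F] [Algebra (ZMod p) E] (ψ : AddChar (ZMod p) Λ)
    (ρ₁ : Representation Λ (AbsGal F) V₁) (ρ₂ : Representation Λ (AbsGal F) V₂) (a₁ a₂ : F)
    (σ₁ σ₂ : AbsGal F) {a : E} {τ₁ : Representation Λ (AbsGal E) V₁}
    {τ₂ : Representation Λ (AbsGal E) V₂} {σ : AbsGal E}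
    (ha : artinSchreierDiff (p := p) a σ = artinSchreierDiff a₁ σ₁ + artinSchreierDiff a₂ σ₂)
    (h₁ : τ₁ σ = ρ₁ σ₁) (h₂ : τ₂ σ = ρ₂ σ₂) :
    (twistEquiv Λ V₁ V₂).toLinearMap.comp
        (TensorProduct.map (Representation.tprod (artinSchreier ψ a₁) ρ₁ σ₁)
          (Representation.tprod (artinSchreier ψ a₂) ρ₂ σ₂))
      = (Representation.tprod (artinSchreier ψ a) (Representation.tprod τ₁ τ₂) σ).comp
        (twistEquiv Λ V₁ V₂).toLinearMap := by
  rw [tprod_artinSchreier_apply, tprod_artinSchreier_apply, tprod_artinSchreier_apply,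
    Representation.tprod_apply, h₁, h₂, ha, AddChar.map_add_eq_mul]
  exact twistEquiv_comp_map _ _ _ _

end Twist

/-! ### Double cosets and the tensor product formula -/

section Main

variable {k : Type u} [Field k]

theorem exists_root_coord (p : ℕ) [Fact p.Prime] [CharP k p] {r : ℕ} (hr : ¬ p ∣ r) :
    ∃ s : SeparableClosure k⸨X⸩, s ^ r = algebraMap k⸨X⸩ _ (coord k) := by
  have hr0 : 0 < r := Nat.pos_of_ne_zero (by rintro rfl; simp at hr)
  obtain ⟨s, hs⟩ := (isKummer_powMap p hr (k := k)).sepClosureLift_surjective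
    (algebraMap _ _ (coord k))
  refine ⟨s, (sepClosureLift (powMap k r)).injective ?_⟩
  rw [map_pow, hs, sepClosureLift_algebraMap, powMap_coord hr0, map_pow]

/-- The double coset decomposition of the absolute Galois group with respect to the subgroups
corresponding to the `r₁`-fold and the `r₂`-fold covering. -/
theorem exists_doubleCoset (p : ℕ) [Fact p.Prime] [CharP k p] {d a b : ℕ}
    (hd : ¬ p ∣ d) (ha : ¬ p ∣ a) (hb : ¬ p ∣ b) (hab : a.Coprime b) {ζ : k}
    (hζ : IsPrimitiveRoot ζ (d * a * b))
    {s : SeparableClosure k⸨X⸩} (hs : s ^ (d * a * b) = algebraMap k⸨X⸩ _ (coord k))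
    (x y : AbsGal k⸨X⸩) (g : Fin d → AbsGal k⸨X⸩)
    (hg : ∀ i, g i s = constHom k (ζ ^ (i : ℕ)) * s) (g₁ g₂ : AbsGal k⸨X⸩) :
    ∃ i h₁ h₂ h, g₁ = galoisMap (powMap k (d * a)) h₁ * (x * h) ∧
      g₂ = galoisMap (powMap k (d * b)) h₂ * (y * (g i)⁻¹ * h) := by
  have hp : p.Prime := Fact.out
  have hda : ¬ p ∣ d * a := by rw [hp.dvd_mul]; exact not_or.2 ⟨hd, ha⟩
  have hdb : ¬ p ∣ d * b := by rw [hp.dvd_mul]; exact not_or.2 ⟨hd, hb⟩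
  have hr : ¬ p ∣ d * a * b := by rw [hp.dvd_mul]; exact not_or.2 ⟨hda, hb⟩
  have : NeZero (d * a * b) := ⟨by intro h; simp [h] at hr⟩
  have : NeZero (d * a) := ⟨by intro h; simp [h] at hda⟩
  have : NeZero (d * b) := ⟨by intro h; simp [h] at hdb⟩
  have : NeZero d := ⟨by intro h; simp [h] at hd⟩
  obtain ⟨e, he⟩ := exists_kummerChar hζ hs
  have hsurj (n : ZMod (d * a * b)) : ∃ g, e g = Multiplicative.ofAdd n := by
    obtain ⟨c, hcn, hc⟩ := isUnit_of_isPrimitiveRoot hζ n.val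
    obtain ⟨g, hg, -⟩ := exists_absGal_rotate p hr hζ hs hc (rotate_surjective c)
    rw [hcn] at hg
    exact ⟨g, ((he g _).2 hg).trans (by rw [ZMod.natCast_zmod_val])⟩
  -- The power `s ^ c'` is a `c`-th root of the coordinate, fixed by `g` when `e g` is a multiple of
  -- `c`.
  have hmem {c c' : ℕ} (hc : ¬ p ∣ c) (hcc : d * a * b = c' * c) (g : AbsGal k⸨X⸩)
      (m : ZMod (d * a * b)) (hgm : e g = Multiplicative.ofAdd (c * m)) :
      g ∈ (galoisMap (powMap k c)).range := by
    have : NeZero c := ⟨by rintro rfl; simp at hc⟩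
    have hsc : (s ^ c') ^ c = algebraMap k⸨X⸩ _ (coord k) := by rw [← pow_mul, ← hcc, hs]
    rw [mem_range_galoisMap_powMap p hc (hζ.pow (NeZero.pos _) hcc) hsc]
    have h1 : g s = constHom k (ζ ^ (c * m.val)) * s := by
      rw [← he, hgm, Nat.cast_mul, ZMod.natCast_zmod_val]
    rw [map_pow, h1, mul_pow, ← map_pow, ← pow_mul, mul_right_comm, mul_comm c, ← hcc, pow_mul,
      hζ.pow_eq_one, one_pow, map_one, one_mul]
  have hgi (i : Fin d) : e (g i) = Multiplicative.ofAdd (((i : ℕ) : ZMod (d * a * b))) :=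
    (he _ _).2 (hg i)
  obtain ⟨A, hA⟩ : ∃ A : ℤ, e (x⁻¹ * g₁) = Multiplicative.ofAdd (A : ZMod (d * a * b)) :=
    ⟨_, congrArg Multiplicative.ofAdd (ZMod.intCast_zmod_cast (Multiplicative.toAdd _)).symm⟩
  obtain ⟨B, hB⟩ : ∃ B : ℤ, e (y⁻¹ * g₂) = Multiplicative.ofAdd (B : ZMod (d * a * b)) :=
    ⟨_, congrArg Multiplicative.ofAdd (ZMod.intCast_zmod_cast (Multiplicative.toAdd _)).symm⟩
  have hd0 : (0 : ℤ) < d := by exact_mod_cast NeZero.pos d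
  -- The value of `e h` must be `A` modulo `d * a` and `B + i` modulo `d * b`. As `a` and `b` are
  -- coprime, this is solvable exactly when `i ≡ A - B` modulo `d`.
  obtain ⟨i, hi⟩ : ∃ i : Fin d, ((i : ℕ) : ℤ) = (A - B) % d := by
    have h0 := Int.emod_nonneg (A - B) hd0.ne'
    have h1 := Int.emod_lt_of_pos (A - B) hd0
    exact ⟨⟨((A - B) % d).toNat, by omega⟩, by simpa using h0⟩
  have hq := Int.emod_add_mul_ediv (A - B) d
  rw [← hi] at hq
  set q := (A - B) / d
  -- With `A - B = i + d q` and `X a + Y b = 1`, the solution is `A - d a X q`, which exceeds `B +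
  -- i` by `d b Y q`.
  obtain ⟨X, Y, hXY⟩ := Nat.isCoprime_iff_coprime.2 hab
  obtain ⟨h, hh⟩ := hsurj ((A - d * a * X * q : ℤ) : ZMod (d * a * b))
  obtain ⟨h₁, hh₁⟩ := hmem hda (c' := b) (by ring) (g₁ * (x * h)⁻¹) ((X * q : ℤ) : ZMod (d * a * b))
    (by
      have : e (g₁ * (x * h)⁻¹) = e (x⁻¹ * g₁) * (e h)⁻¹ := by
        simp only [map_mul, map_inv, mul_inv]
        ac_rfl
      rw [this, hA, hh, ← ofAdd_neg, ← ofAdd_add]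
      congr 1
      push_cast
      ring)
  obtain ⟨h₂, hh₂⟩ := hmem hdb (c' := a) (by ring) (g₂ * (y * (g i)⁻¹ * h)⁻¹)
    ((-(Y * q) : ℤ) : ZMod (d * a * b)) (by
      have : e (g₂ * (y * (g i)⁻¹ * h)⁻¹) = e (y⁻¹ * g₂) * e (g i) * (e h)⁻¹ := by
        simp only [map_mul, map_inv, mul_inv, inv_inv]
        ac_rfl
      rw [this, hB, hh, hgi, ← ofAdd_add, ← ofAdd_neg, ← ofAdd_add]
      congr 1
      have hz : B + (i : ℕ) - (A - d * a * X * q) = (d * b : ℕ) * (-(Y * q)) := by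
        push_cast
        linear_combination hq + d * q * hXY
      have := congrArg (Int.cast : ℤ → ZMod (d * a * b)) hz
      push_cast at this ⊢
      linear_combination this)
  exact ⟨i, h₁, h₂, h, by rw [hh₁]; group, by rw [hh₂]; group⟩

theorem apply_galoisMap_conjAbsGal (p : ℕ) [Fact p.Prime] [IsAlgClosed k] [CharP k p]
    {Λ V : Type*} [Field Λ] [AddCommGroup V] [Module Λ V] {ρ : Representation Λ (AbsGal k⸨X⸩) V}
    (hρ : IsTame p ρ) {b : ℕ} (hb : 0 < b) (c : kˣ) (σ : AbsGal k⸨X⸩) :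
    ρ (galoisMap (powMap k b) (conjAbsGal (rotate c) (rotate_surjective c) σ))
      = ρ (galoisMap (powMap k b) σ) := by
  have h := hρ _ (galoisMap_conjAbsGal_mem_wildInertia p hb c σ)
  conv_lhs => rw [← inv_mul_cancel_right
    (galoisMap (powMap k b) (conjAbsGal (rotate c) (rotate_surjective c) σ))
    (galoisMap (powMap k b) σ), map_mul, h, one_mul]

/-- The extension of the rotation composed with the chosen embedding lies over `u ↦ (c u)^b`, so
functoriality of the cocycle applies. -/
theorem artinSchreierDiff_galoisMap_conjAbsGal (p : ℕ) [Fact p.Prime] [Algebra (ZMod p) k]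
    {b : ℕ} (hb : 0 < b) (c : kˣ) (P : Polynomial k) (σ : AbsGal k⸨X⸩) :
    artinSchreierDiff (p := p) (evalInv P (coord k))
        (galoisMap (powMap k b) (conjAbsGal (rotate c) (rotate_surjective c) σ))
      = artinSchreierDiff (evalInv P ((HahnSeries.C (c : k) * coord k) ^ b)) σ := by
  have hf (a : k) : (rotate c).comp (powMap k b) (HahnSeries.C a) = HahnSeries.C a := by
    rw [RingHom.comp_apply, powMap_C hb, rotate_C]
  have hx : (rotate c).comp (powMap k b) (coord k) = (HahnSeries.C (c : k) * coord k) ^ b := by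
    rw [RingHom.comp_apply, powMap_coord hb, map_pow, rotate_coord]
  rw [← hx, ← map_evalInv _ hf]
  refine artinSchreierDiff_eq
    ((sepClosureEquiv (rotate c) (rotate_surjective c) :
      SeparableClosure k⸨X⸩ →+* SeparableClosure k⸨X⸩).comp (sepClosureLift (powMap k b)))
    (fun x => ?_) _ fun z => ?_
  · rw [RingHom.comp_apply, sepClosureLift_algebraMap]
    exact sepClosureEquiv_algebraMap _ _ _
  · rw [RingHom.comp_apply, galoisMap_spec]
    exact conjAbsGal_spec _ _ _ _

theorem artinSchreierDiff_galoisMap_powMap (p : ℕ) [Fact p.Prime] [Algebra (ZMod p) k]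
    {b : ℕ} (hb : 0 < b) (P : Polynomial k) (σ : AbsGal k⸨X⸩) :
    artinSchreierDiff (p := p) (evalInv P (coord k)) (galoisMap (powMap k b) σ)
      = artinSchreierDiff (evalInv P (coord k ^ b)) σ := by
  rw [artinSchreierDiff_eq (sepClosureLift (powMap k b)) (sepClosureLift_algebraMap _) _
    (galoisMap_spec _ _), map_evalInv _ (powMap_C hb), powMap_coord hb]

theorem nonempty_equiv_tprod_pushforward_artinSchreier (p : ℕ) [Fact p.Prime]
    [Algebra (ZMod p) k] [IsAlgClosed k] {Λ V₁ V₂ : Type*} [Field Λ] [AddCommGroup V₁]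
    [Module Λ V₁] [Module.Finite Λ V₁] [AddCommGroup V₂] [Module Λ V₂] [Module.Finite Λ V₂]
    (ψ : AddChar (ZMod p) Λ) (φ₁ φ₂ : Polynomial k)
    (K₁ : Representation Λ (AbsGal k⸨X⸩) V₁) (K₂ : Representation Λ (AbsGal k⸨X⸩) V₂)
    (hK₂t : IsTame p K₂) {d r₁' r₂' : ℕ} (hr₁ : ¬ p ∣ d * r₁') (hr₂ : ¬ p ∣ d * r₂')
    (hcop : r₁'.Coprime r₂') {ζ : k} (hζ : IsPrimitiveRoot ζ (d * r₁' * r₂')) :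
    Nonempty (Representation.Equiv
      (Representation.tprod
        (pushforward (powMap k (d * r₁'))
          (Representation.tprod
            (artinSchreier ψ (evalInv φ₁ (coord k))) K₁))
        (pushforward (powMap k (d * r₂'))
          (Representation.tprod
            (artinSchreier ψ (evalInv φ₂ (coord k))) K₂)))
      (Representation.directSum fun i : Fin d =>
        pushforward (powMap k (d * r₁' * r₂'))
          (Representation.tprod
            (artinSchreier ψ
              (evalInv φ₁ (coord k ^ r₂')
                + evalInv φ₂
                    ((HahnSeries.C (ζ ^ (i : ℕ)) * coord k) ^ r₁')))
            (Representation.tprod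
              (pullback (powMap k r₂') K₁)
              (pullback (powMap k r₁') K₂))))) := by
  have hp : p.Prime := Fact.out
  have : CharP k p := charP_of_injective_ringHom (algebraMap (ZMod p) k).injective p
  have hd0 : 0 < d := Nat.pos_of_ne_zero (by rintro rfl; simp at hr₁)
  have hpd : ¬ p ∣ d := fun h => hr₁ (h.mul_right _)
  have hpa : ¬ p ∣ r₁' := fun h => hr₁ (h.mul_left _)
  have hpb : ¬ p ∣ r₂' := fun h => hr₂ (h.mul_left _)
  have hpr : ¬ p ∣ d * r₁' * r₂' := by
    rw [hp.dvd_mul]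
    exact not_or.2 ⟨hr₁, hpb⟩
  have ha0 : 0 < r₁' := Nat.pos_of_ne_zero (by rintro rfl; simp at hpa)
  have hb0 : 0 < r₂' := Nat.pos_of_ne_zero (by rintro rfl; simp at hpb)
  have : NeZero (d * r₁' * r₂') := ⟨by positivity⟩
  obtain ⟨s, hs⟩ := exists_root_coord (k := k) p hpr
  obtain ⟨x, hx⟩ := exists_conj_galoisMap_powMap (k := k) p hr₁ hpb
  obtain ⟨y, hy⟩ := exists_conj_galoisMap_powMap (k := k) p hr₂ hpa
  rw [show d * r₂' * r₁' = d * r₁' * r₂' by ring] at hy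
  choose c hc hcr using fun i : Fin d => isUnit_of_isPrimitiveRoot hζ i
  choose g hg hgσ using fun i : Fin d =>
    exists_absGal_rotate p hpr hζ hs (hcr i) (rotate_surjective (c i))
  have hi₁ := index_range_galoisMap_powMap p hr₁ (hζ.pow (NeZero.pos _) (mul_comm _ r₂'))
  have hi₂ := index_range_galoisMap_powMap p hr₂ (hζ.pow (NeZero.pos _)
    (show d * r₁' * r₂' = r₁' * (d * r₂') by ring))
  have hi := index_range_galoisMap_powMap p hpr hζ
  have : (galoisMap (powMap k (d * r₁'))).range.FiniteIndex := ⟨by rw [hi₁]; positivity⟩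
  have : (galoisMap (powMap k (d * r₂'))).range.FiniteIndex := ⟨by rw [hi₂]; positivity⟩
  have : (galoisMap (powMap k (d * r₁' * r₂'))).range.FiniteIndex := ⟨by rw [hi]; positivity⟩
  refine nonempty_equiv_tprod_coind (ι := Fin d) (galoisMap (powMap k (d * r₁')))
    (galoisMap (powMap k (d * r₂'))) (galoisMap (powMap k (d * r₁' * r₂')))
    (galoisMap_injective (isKummer_powMap p hr₁).sepClosureLift_surjective)
    (galoisMap_injective (isKummer_powMap p hr₂).sepClosureLift_surjective)
    (galoisMap_injective (isKummer_powMap p hpr).sepClosureLift_surjective) _ _ _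
    (fun _ => galoisMap (powMap k r₂'))
    -- Moving `(g i)⁻¹` past the Galois image of `σ` conjugates `σ` by the `i`-th rotation, so only
    -- the second factor is rotated.
    (fun i σ => galoisMap (powMap k r₁') (conjAbsGal (rotate (c i)) (rotate_surjective (c i)) σ))
    (fun _ => x) (fun i => y * (g i)⁻¹) (fun _ => hx) (fun i σ => ?_)
    (exists_doubleCoset p hpd hpa hpb hcop hζ hs x y g fun i => by rw [hg, hc]) ?_
    (twistEquiv Λ V₁ V₂) fun i σ => ?_
  · have hgi : galoisMap (powMap k (d * r₁' * r₂'))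
        (conjAbsGal (rotate (c i)) (rotate_surjective (c i)) σ) * (g i)⁻¹
        = (g i)⁻¹ * galoisMap (powMap k (d * r₁' * r₂')) σ := by
      rw [eq_inv_mul_iff_mul_eq, ← mul_assoc, hgσ, mul_inv_cancel_right]
    calc _ = _ * (y * (g i)⁻¹) := rfl
      _ = y * (galoisMap (powMap k (d * r₁' * r₂'))
        (conjAbsGal (rotate (c i)) (rotate_surjective (c i)) σ) * (g i)⁻¹) := by
        rw [← mul_assoc, hy, mul_assoc]
      _ = _ := by rw [hgi, ← mul_assoc]
  · rw [hi₁, hi₂, hi, Fintype.card_fin]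
    ring
  · refine twistEquiv_comp_tprod_artinSchreier ψ K₁ K₂ _ _ _ _ ?_ rfl ?_
    · rw [artinSchreierDiff_add, artinSchreierDiff_galoisMap_powMap p hb0,
        artinSchreierDiff_galoisMap_conjAbsGal p ha0, hc]
    · exact (apply_galoisMap_conjAbsGal p hK₂t ha0 _ _).symm

end Main

end LocalSystems

theorem proposition4p3
    (p : ℕ) [Fact p.Prime] (ℓ : ℕ) [Fact ℓ.Prime] (hℓp : ℓ ≠ p)
    (k : Type*) [Field k] [Algebra (ZMod p) k] [IsAlgClosure (ZMod p) k]
    (ψ : AddChar (ZMod p) (PadicAlgCl ℓ)) (hψ : ψ ≠ 1)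
    (r₁ r₂ : ℕ) (hr₁ : ¬ p ∣ r₁) (hr₂ : ¬ p ∣ r₂)
    (φ₁ φ₂ : Polynomial k) (hφ₁ : φ₁.coeff 0 = 0) (hφ₂ : φ₂.coeff 0 = 0)
    {V₁ V₂ : Type*} [AddCommGroup V₁] [Module (PadicAlgCl ℓ) V₁]
    [AddCommGroup V₂] [Module (PadicAlgCl ℓ) V₂]
    (K₁ : Representation (PadicAlgCl ℓ) (LocalSystems.AbsGal (LaurentSeries k)) V₁)
    (K₂ : Representation (PadicAlgCl ℓ) (LocalSystems.AbsGal (LaurentSeries k)) V₂)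
    (hK₁ : LocalSystems.IsLocalSystem K₁) (hK₂ : LocalSystems.IsLocalSystem K₂)
    (hK₁t : LocalSystems.IsTame p K₁) (hK₂t : LocalSystems.IsTame p K₂)
    (d r₁' r₂' r : ℕ) (hd : d = Nat.gcd r₁ r₂) (hr₁' : r₁' = r₁ / d) (hr₂' : r₂' = r₂ / d)
    (hr : r = r₁ * r₂ / d)
    (ζ : k) (hζ : IsPrimitiveRoot ζ r) :
    Nonempty (Representation.Equiv
      (Representation.tprod
        (LocalSystems.pushforward (LocalSystems.powMap k r₁)
          (Representation.tprod
            (LocalSystems.artinSchreier ψ (LocalSystems.evalInv φ₁ (LocalSystems.coord k))) K₁))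
        (LocalSystems.pushforward (LocalSystems.powMap k r₂)
          (Representation.tprod
            (LocalSystems.artinSchreier ψ (LocalSystems.evalInv φ₂ (LocalSystems.coord k))) K₂)))
      (Representation.directSum fun i : Fin d =>
        LocalSystems.pushforward (LocalSystems.powMap k r)
          (Representation.tprod
            (LocalSystems.artinSchreier ψ
              (LocalSystems.evalInv φ₁ (LocalSystems.coord k ^ r₂')
                + LocalSystems.evalInv φ₂
                    ((HahnSeries.C (ζ ^ (i : ℕ)) * LocalSystems.coord k) ^ r₁')))
            (Representation.tprod
              (LocalSystems.pullback (LocalSystems.powMap k r₂') K₁)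
              (LocalSystems.pullback (LocalSystems.powMap k r₁') K₂))))) := by
  have : IsAlgClosed k := IsAlgClosure.isAlgClosed (ZMod p)
  have hd0 : 0 < d := hd ▸ Nat.gcd_pos_of_pos_left _
    (Nat.pos_of_ne_zero (by rintro rfl; simp at hr₁))
  have h1 : r₁ = d * r₁' := by
    rw [hr₁', Nat.mul_div_cancel' (hd ▸ Nat.gcd_dvd_left _ _)]
  have h2 : r₂ = d * r₂' := by
    rw [hr₂', Nat.mul_div_cancel' (hd ▸ Nat.gcd_dvd_right _ _)]
  have hcop : r₁'.Coprime r₂' := by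
    rw [hr₁', hr₂', hd]
    exact Nat.coprime_div_gcd_div_gcd (hd ▸ hd0)
  have h3 : r = d * r₁' * r₂' := by
    rw [hr, h1, h2, mul_left_comm, Nat.mul_div_cancel_left _ hd0]
  clear hr hr₁' hr₂' hd
  subst h1 h2 h3
  have := hK₁.finite
  have := hK₂.finite
  exact LocalSystems.nonempty_equiv_tprod_pushforward_artinSchreier p ψ φ₁ φ₂ K₁ K₂ hK₂t hr₁ hr₂
    hcop hζ
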